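/- For $N\ge 1$ let $\mathfrak Y_N$ be the set of integer vectors $\lambda=(\lambda_1\ge\dots\ge\lambda_N\ge 0)$, put $|\lambda|=\lambda_1+\dots+\lambda_N$, and for a unitary matrix $U\in\mathbb U_N$ with eigenvalues $u_1,\dots,u_N$ let $s_\lambda(U)$ be the Schur polynomial $$s_\lambda(x_1,\dots,x_N)=\frac{\det[x_j^{N-i+\lambda_i}]_{i,j=1}^N}{\det[x_j^{N-i}]_{i,j=1}^N}$$ (a polynomial quotient) evaluated at $x=(u_1,\dots,u_N)$. Let $q\in(0,1)$ be fixed, and let $$Z_N=Z_N(U)=\sum_{\lambda\in\mathfrak Y_N}q^{|\lambda|}\,|s_\lambda(U)|^2$$ be the partition function of the Schur measure on $\mathfrak Y_N$, which gives $\lambda$ the mass $q^{|\lambda|}|s_\lambda(U)|^2/Z_N$. Let $\mathbb E$ denote expectation with respect to the Haar probability measure on $\mathbb U_N$, so that $U=U_N$ is a Haar-distributed random unitary matrix (CUE). Then the series $Z_N$ converges to a positive number for every $U \in \mathbb U_N$, $Z_N$ and $\log Z_N$ are integrable, and $$\lim_{N\to\infty}\bigl(\log\mathbb E Z_N-\mathbb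 E\log Z_N\bigr)=\sum_{n=2}^\infty\frac{q^n}{1-q^n}\,\frac1n=-\log\phi(q)-\frac{q}{1-q},$$ where $\phi(q)=\prod_{n=1}^\infty(1-q^n)$ is Euler's function; here the series converges, and the product converges to a positive number. The limit is strictly positive. -/

import Mathlib

open MeasureTheory Filter Topology

noncomputable section

namespace SchurCUE

/-- `YN N`: weakly decreasing vectors `lam = (lam_1 ≥ ... ≥ lam_N ≥ 0)` of nonnegative integers,
i.e. partitions with at most `N` nonzero parts. Coordinates are indexed from `0`. -/
def YN (N : ℕ) : Type := {lam : Fin N → ℕ // Antitone lam}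

/-- The number `|lam| = lam_1 + ... + lam_N` partitioned by `lam`. -/
def YN.size {N : ℕ} (lam : YN N) : ℕ := ∑ i, lam.1 i

/-- The alternant `det [x_j ^ (N - i + lam_i)]` (with `1 ≤ i, j ≤ N`), as a polynomial in
`x_1, ..., x_N`. -/
def alternant {N : ℕ} (lam : Fin N → ℕ) : MvPolynomial (Fin N) ℂ :=
  Matrix.det (Matrix.of fun i j : Fin N =>
    (MvPolynomial.X j : MvPolynomial (Fin N) ℂ) ^ (lam i + (N - 1 - (i : ℕ))))

/-- Every alternant is divisible by the Weyl denominator `det [x_j ^ (N - i)]`. -/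
theorem alternant_dvd {N : ℕ} (lam : Fin N → ℕ) : alternant (0 : Fin N → ℕ) ∣ alternant lam := by
  classical
  let R := MvPolynomial (Fin N) ℂ
  let P : Polynomial R := ∏ l : Fin N, (Polynomial.X - Polynomial.C (MvPolynomial.X l : R))
  have hP : P.Monic := Polynomial.monic_prod_X_sub_C _ _
  have hdeg : P.natDegree = N := by
    simp [P]
  let r : ℕ → Polynomial R := fun m => (Polynomial.X ^ m) %ₘ P
  have key : ∀ (m : ℕ) (j : Fin N),
      (MvPolynomial.X j : R) ^ m
        = ∑ k : Fin N, (r m).coeff (N - 1 - (k : ℕ)) * (MvPolynomial.X j : R) ^ (N - 1 - (k : ℕ)) := by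
    intro m j
    have h1 := congrArg (Polynomial.eval (MvPolynomial.X j : R))
      (Polynomial.modByMonic_add_div (Polynomial.X ^ m : Polynomial R) P)
    have h0 : Polynomial.eval (MvPolynomial.X j : R) P = 0 := by
      simp only [P, Polynomial.eval_prod]
      exact Finset.prod_eq_zero (Finset.mem_univ j) (by simp)
    simp only [Polynomial.eval_add, Polynomial.eval_mul, h0, zero_mul, add_zero,
      Polynomial.eval_pow, Polynomial.eval_X] at h1
    have hN : 0 < N := Fin.pos j
    have hlt : (r m).natDegree < N := by
      have h2 := Polynomial.natDegree_modByMonic_lt (Polynomial.X ^ m : Polynomial R) hP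
        (by intro h; rw [h] at hdeg; simp at hdeg; omega)
      rwa [hdeg] at h2
    rw [← h1, Polynomial.eval_eq_sum_range' hlt, ← Fin.sum_univ_eq_sum_range
      (fun k => (r m).coeff k * (MvPolynomial.X j : R) ^ k),
      ← Equiv.sum_comp Fin.revPerm]
    refine Finset.sum_congr rfl fun k _ => ?_
    have : ((Fin.revPerm k : Fin N) : ℕ) = N - 1 - (k : ℕ) := by
      simp [Fin.val_rev]; omega
    rw [this]
  refine ⟨Matrix.det (Matrix.of fun i k : Fin N =>
    (r (lam i + (N - 1 - (i : ℕ)))).coeff (N - 1 - (k : ℕ))), ?_⟩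
  unfold alternant
  rw [mul_comm, ← Matrix.det_mul]
  congr 1
  ext1 i j
  simp only [Matrix.mul_apply, Matrix.of_apply, Pi.zero_apply, zero_add]
  exact key _ _

/-- The Schur polynomial `s_lam(x_1, ..., x_N)`: the polynomial quotient
`det [x_j ^ (N - i + lam_i)] / det [x_j ^ (N - i)]`. -/
def schurPoly {N : ℕ} (lam : YN N) : MvPolynomial (Fin N) ℂ :=
  Classical.choose (alternant_dvd lam.1)

/-- The defining property of the Schur polynomial (Weyl character formula). -/
theorem alternant_zero_mul_schurPoly {N : ℕ} (lam : YN N) :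
    alternant (0 : Fin N → ℕ) * schurPoly lam = alternant lam.1 :=
  (Classical.choose_spec (alternant_dvd lam.1)).symm

theorem alternant_zero_ne_zero (N : ℕ) : alternant (0 : Fin N → ℕ) ≠ 0 := by
  have h : alternant (0 : Fin N → ℕ) = Matrix.det
      ((Matrix.vandermonde (MvPolynomial.X : Fin N → MvPolynomial (Fin N) ℂ)).transpose.submatrix
        Fin.revPerm id) := by
    unfold alternant
    congr 1
    ext1 i j
    simp only [Matrix.of_apply, Pi.zero_apply, zero_add, Matrix.submatrix_apply,
      Matrix.transpose_apply, Matrix.vandermonde_apply, id]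
    congr 1
    simp [Fin.val_rev]; omega
  rw [h, Matrix.det_permute, Matrix.det_transpose]
  refine mul_ne_zero ?_ (Matrix.det_vandermonde_ne_zero_iff.2 (MvPolynomial.X_injective))
  rcases Int.units_eq_one_or (Equiv.Perm.sign (Fin.revPerm : Equiv.Perm (Fin N))) with h | h <;>
    simp [h]

theorem rename_alternant {N : ℕ} (lam : Fin N → ℕ) (e : Equiv.Perm (Fin N)) :
    MvPolynomial.rename e (alternant lam)
      = ((Equiv.Perm.sign e : ℤ) : MvPolynomial (Fin N) ℂ) * alternant lam := by
  unfold alternant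
  rw [← Matrix.det_permute', AlgHom.map_det]
  congr 1
  ext1 i j
  simp

/-- Schur polynomials are symmetric. -/
theorem schurPoly_isSymmetric {N : ℕ} (lam : YN N) : (schurPoly lam).IsSymmetric := by
  intro e
  have h := congrArg (MvPolynomial.rename e) (alternant_zero_mul_schurPoly lam)
  rw [map_mul, rename_alternant, rename_alternant, ← alternant_zero_mul_schurPoly lam,
    mul_assoc] at h
  have hs : ((Equiv.Perm.sign e : ℤ) : MvPolynomial (Fin N) ℂ) ≠ 0 := by
    rcases Int.units_eq_one_or (Equiv.Perm.sign e) with h | h <;> simp [h]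
  exact mul_left_cancel₀ (alternant_zero_ne_zero N) (mul_left_cancel₀ hs h)

/-- The unitary group `U(N)` of complex `N × N` matrices. -/
abbrev UN (N : ℕ) : Type := Matrix.unitaryGroup (Fin N) ℂ

theorem exists_eigenvalues {N : ℕ} (U : UN N) :
    ∃ u : Fin N → ℂ, Finset.univ.val.map u = (U : Matrix (Fin N) (Fin N) ℂ).charpoly.roots := by
  have hc : (U : Matrix (Fin N) (Fin N) ℂ).charpoly.roots.toList.length = N := by
    rw [Multiset.length_toList, IsAlgClosed.card_roots_eq_natDegree,
      Matrix.charpoly_natDegree_eq_dim, Fintype.card_fin]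
  refine ⟨fun i => (U : Matrix (Fin N) (Fin N) ℂ).charpoly.roots.toList.get (i.cast hc.symm), ?_⟩
  rw [Fin.univ_val_map]
  conv_rhs => rw [← Multiset.coe_toList (U : Matrix (Fin N) (Fin N) ℂ).charpoly.roots]
  congr 1
  refine List.ext_get (by simp [hc]) fun n h1 h2 => ?_
  simp

/-- The eigenvalues `u_1, ..., u_N` of `U`, listed with algebraic multiplicity, in some order. -/
def eigenvalues {N : ℕ} (U : UN N) : Fin N → ℂ := Classical.choose (exists_eigenvalues U)

/-- The Schur function `s_lam(U)`: the Schur polynomial evaluated at the eigenvalues of `U`. -/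
def schur {N : ℕ} (lam : YN N) (U : UN N) : ℂ :=
  MvPolynomial.eval (eigenvalues U) (schurPoly lam)

/-- `s_lam(U)` does not depend on the order in which the eigenvalues of `U` are listed. -/
theorem schur_eq {N : ℕ} (lam : YN N) (U : UN N) (u : Fin N → ℂ)
    (hu : Finset.univ.val.map u = (U : Matrix (Fin N) (Fin N) ℂ).charpoly.roots) :
    schur lam U = MvPolynomial.eval u (schurPoly lam) := by
  have h : Finset.univ.val.map u = Finset.univ.val.map (eigenvalues U) :=
    hu.trans (Classical.choose_spec (exists_eigenvalues U)).symm
  have hfib : ∀ c : ℂ, Nonempty ({i // u i = c} ≃ {i // eigenvalues U i = c}) := by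
    intro c
    classical
    have hc := congrArg (Multiset.count c) h
    rw [Multiset.count_map, Multiset.count_map] at hc
    refine Fintype.card_eq.1 ?_
    rw [Fintype.card_subtype, Fintype.card_subtype]
    simpa [Finset.card, eq_comm] using hc
  let e : Equiv.Perm (Fin N) := Equiv.ofFiberEquiv fun c => (hfib c).some
  have he : eigenvalues U ∘ e = u := funext fun i => Equiv.ofFiberEquiv_map _ i
  rw [schur, ← he, ← MvPolynomial.eval_rename, schurPoly_isSymmetric lam e]

/-- The partition function `Z_N = ∑ q^|lam| |s_lam(U)|^2`, the sum being over all partitions `lam`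
with at most `N` nonzero parts; the Schur measure gives `lam` the mass
`q^|lam| |s_lam(U)|^2 / Z_N`. -/
def partitionFunction (q : ℝ) {N : ℕ} (U : UN N) : ℝ :=
  ∑' lam : YN N, q ^ lam.size * ‖schur lam U‖ ^ 2

instance (N : ℕ) : CompactSpace (UN N) := by
  suffices h : IsCompact ((Matrix.unitaryGroup (Fin N) ℂ :
      Submonoid (Matrix (Fin N) (Fin N) ℂ)) : Set (Matrix (Fin N) (Fin N) ℂ)) from
    isCompact_iff_compactSpace.1 h
  have hK : IsCompact (Set.univ.pi fun _ : Fin N => Set.univ.pi fun _ : Fin N =>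
      Metric.closedBall (0 : ℂ) 1) :=
    isCompact_univ_pi fun _ => isCompact_univ_pi fun _ => isCompact_closedBall 0 1
  refine hK.of_isClosed_subset ?_ ?_
  · have : ((Matrix.unitaryGroup (Fin N) ℂ : Submonoid (Matrix (Fin N) (Fin N) ℂ)) :
        Set (Matrix (Fin N) (Fin N) ℂ)) = {A | A * star A = 1} := by
      ext A; exact Matrix.mem_unitaryGroup_iff
    rw [this]
    exact isClosed_eq (by fun_prop) continuous_const
  · intro A hA i _ j _
    simpa using entry_norm_bound_of_unitary hA i j

instance (N : ℕ) : MeasurableSpace (UN N) := borel _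

instance (N : ℕ) : BorelSpace (UN N) := ⟨rfl⟩

/-- The Circular Unitary Ensemble: Haar measure on `U(N)`, normalized to total mass `1`. -/
def cue (N : ℕ) : Measure (UN N) := Measure.haarMeasure ⊤

instance (N : ℕ) : IsProbabilityMeasure (cue N) :=
  ⟨by simpa [cue] using Measure.haarMeasure_self (K₀ := (⊤ : TopologicalSpace.PositiveCompacts (UN N)))⟩

/-- The disorder gap `log E Z_N - E log Z_N` between the annealed and the quenched free energy,
`E` being expectation under Haar measure on `U(N)`. -/
def disorderGap (q : ℝ) (N : ℕ) : ℝ :=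
  Real.log (∫ U, partitionFunction q U ∂(cue N)) - ∫ U, Real.log (partitionFunction q U) ∂(cue N)

/-- Euler's function `φ(q) = ∏_{n ≥ 1} (1 - q^n)`. -/
def eulerPhi (q : ℝ) : ℝ := ∏' n : ℕ, (1 - q ^ (n + 1))

end SchurCUE

end

/-! By the Cauchy identity, $Z_N(U)=\prod_{i,j}(1-q\,u_i\bar
u_j)^{-1}=\exp\sum_{k\ge1}\frac{q^k}{k}|\mathrm{tr}\,U^k|^2$ (`hasSum_partitionFunction`,
`exp_logPartition`). The two expectations are then found by different means.

Annealed part. The coefficient of $q^n$ in $Z_N$ is the trace of $U$ on the degree $n$ forms in the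
entries of an $N\times N$ matrix, $U$ acting by conjugation. Its Haar mean is the dimension of the
space of invariant forms. The invariants form a polynomial ring in the characteristic coefficients,
of degrees $1,\dots,N$, so $\mathbb E Z_N=\prod_{k\le N}(1-q^k)^{-1}$ (`finrank_invariantForms`,
`integral_exp_logPartition`). This converges to $1/\phi(q)$ and is bounded uniformly in $N$.

Quenched part. $\mathbb E\log Z_N=\sum_k\frac{q^k}{k}\mathbb E|\mathrm{tr}\,U^k|^2$. Invariance of
Haar measure gives the Schwinger–Dyson equation `schwinger_dyson`, whose dominant term is
$N\,\mathbb E|\mathrm{tr}\,U^k|^2$ and whose right side is $kN$. The other terms are bounded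
uniformly in $N$, because $Z_N$ at a fixed parameter dominates all mixed moments involved. Hence
$\mathbb E|\mathrm{tr}\,U^k|^2\to k$, and by dominated convergence $\mathbb E\log Z_N\to\sum_k
q^k=q/(1-q)$.

Finally $-\log\phi(q)$ is the full Lambert series, and $q/(1-q)$ is its $n=1$ term. -/

noncomputable section

namespace SchurCUE

/-! ### Cauchy determinant and Cauchy–Binet expansion -/

section Cauchy

variable {R : Type*} [CommRing R] {N : ℕ}

/-- The alternant `det [x_j ^ (lam_i + N - 1 - i)]` at a point of a commutative ring. -/
def altDet (lam : Fin N → ℕ) (x : Fin N → R) : R :=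
  Matrix.det (Matrix.of fun i j : Fin N => x j ^ (lam i + (N - 1 - (i : ℕ))))

theorem altDet_zero (x : Fin N → R) :
    altDet (0 : Fin N → ℕ) x = ∏ i : Fin N, ∏ j ∈ Finset.Ioi i, (x i - x j) := by
  have h := Matrix.det_projVandermonde (1 : Fin N → R) x
  simp only [Pi.one_apply, one_mul] at h
  rw [← h, altDet, ← Matrix.det_transpose]
  congr 1
  ext i j
  simp only [Matrix.transpose_apply, Matrix.of_apply, Pi.zero_apply, zero_add,
    Matrix.projVandermonde_apply, Pi.one_apply, one_pow, one_mul, Fin.val_rev]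
  congr 1
  omega

/-- Each alternant differs from its Vandermonde determinant by the same sign, which cancels in the
product. -/
theorem altDet_zero_mul_altDet_zero (x y : Fin N → R) :
    altDet (0 : Fin N → ℕ) x * altDet 0 y
      = (Matrix.vandermonde x).det * (Matrix.vandermonde y).det := by
  rw [altDet_zero, altDet_zero, Matrix.det_vandermonde, Matrix.det_vandermonde,
    ← Finset.prod_mul_distrib, ← Finset.prod_mul_distrib]
  refine Finset.prod_congr rfl fun i _ => ?_
  rw [← Finset.prod_mul_distrib, ← Finset.prod_mul_distrib]
  exact Finset.prod_congr rfl fun j _ => by ring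

/-- The homogeneous form allows two specializations with the same coefficients: $a=1$ gives Lagrange
products at the node $s$, and $s=1$ gives the entries of the Cauchy matrix. -/
theorem exists_coeff_prod_sub_mul {ι : Type*} (x : ι → R) (T : Finset ι) :
    ∃ c : ℕ → R, ∀ s a : R, ∏ l ∈ T, (s - x l * a)
      = ∑ k ∈ Finset.range (T.card + 1), c k * (a ^ k * s ^ (T.card - k)) := by
  classical
  refine ⟨fun k => ∑ t ∈ Finset.powersetCard k T, ∏ l ∈ t, (-x l), fun s a => ?_⟩
  have h : ∀ l ∈ T, s - x l * a = (-x l * a) + s := fun l _ => by ring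
  rw [Finset.prod_congr rfl h, Finset.prod_add, Finset.sum_powerset]
  refine Finset.sum_congr rfl fun k _ => ?_
  rw [Finset.sum_mul]
  refine Finset.sum_congr rfl fun t ht => ?_
  rw [Finset.mem_powersetCard] at ht
  rw [Finset.prod_mul_distrib, Finset.prod_const, Finset.prod_const,
    Finset.card_sdiff_of_subset ht.1, ht.2, mul_assoc]

theorem prod_prod_erase_sub (x : Fin N → R) :
    ∏ i, ∏ l ∈ Finset.univ.erase i, (x i - x l)
      = (Matrix.vandermonde x).det * altDet (0 : Fin N → ℕ) x := by
  rw [altDet_zero, Matrix.det_vandermonde]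
  have h : ∀ i : Fin N, ∏ l ∈ Finset.univ.erase i, (x i - x l)
      = (∏ l ∈ Finset.Iio i, (x i - x l)) * ∏ l ∈ Finset.Ioi i, (x i - x l) := by
    intro i
    rw [← Finset.prod_union]
    · congr 1
      ext l
      simp [lt_or_lt_iff_ne]
    · rw [Finset.disjoint_left]
      intro l h1 h2
      simp only [Finset.mem_Iio, Finset.mem_Ioi] at h1 h2
      exact lt_asymm h1 h2
  rw [Finset.prod_congr rfl fun i _ => h i, Finset.prod_mul_distrib]
  congr 1
  exact Finset.prod_comm' (by simp)

/-- The Cauchy determinant, with denominators cleared. -/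
theorem det_prod_one_sub_mul [IsDomain R] (x y : Fin N → R) (hx : altDet (0 : Fin N → ℕ) x ≠ 0) :
    Matrix.det (Matrix.of fun i j : Fin N => ∏ l ∈ Finset.univ.erase i, (1 - x l * y j))
      = altDet 0 x * altDet 0 y := by
  choose c hc using fun i : Fin N => exists_coeff_prod_sub_mul x (Finset.univ.erase i)
  have hc' : ∀ (i : Fin N) (s a : R), ∏ l ∈ Finset.univ.erase i, (s - x l * a)
      = ∑ k : Fin N, c i k * (a ^ (k : ℕ) * s ^ (N - 1 - (k : ℕ))) := by
    intro i s a
    have hcard : (Finset.univ.erase i).card = N - 1 := by simp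
    have hN : N - 1 + 1 = N := Nat.sub_add_cancel (Fin.pos i)
    rw [hc i s a, hcard, hN]
    exact (Fin.sum_univ_eq_sum_range (fun k => c i k * (a ^ k * s ^ (N - 1 - k))) N).symm
  let A : Matrix (Fin N) (Fin N) R := Matrix.of fun i k => c i k
  -- By Lagrange interpolation: $\prod_{l\ne i}(x_j-x_l)$ vanishes for $j\ne i$, so `A` times the
  -- alternant matrix of $x$ is diagonal. Cancelling the alternant leaves $\det A$ equal to the
  -- Vandermonde determinant of $x$; the Cauchy matrix is `A` times the transposed Vandermonde
  -- matrix of $y$.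
  have h1 : A.det * altDet 0 x = (Matrix.vandermonde x).det * altDet (0 : Fin N → ℕ) x := by
    rw [← prod_prod_erase_sub, altDet, ← Matrix.det_mul, ← Matrix.det_diagonal]
    congr 1
    ext i j
    rw [Matrix.mul_apply]
    simp only [A, Matrix.of_apply, Pi.zero_apply, zero_add]
    have h := hc' i (x j) 1
    simp only [one_pow, one_mul, mul_one] at h
    rw [← h]
    by_cases hij : i = j
    · subst hij
      simp
    · rw [Matrix.diagonal_apply_ne _ hij]
      exact Finset.prod_eq_zero (Finset.mem_erase.2 ⟨Ne.symm hij, Finset.mem_univ j⟩) (sub_self _)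
  have h2 := mul_right_cancel₀ hx h1
  rw [altDet_zero_mul_altDet_zero, ← h2, ← Matrix.det_transpose (Matrix.vandermonde y),
    ← Matrix.det_mul]
  congr 1
  ext i j
  rw [Matrix.mul_apply]
  simpa [A] using hc' i 1 (y j)

/-- Strictly decreasing exponent vectors are shifted partitions. -/
def YN.shift (lam : YN N) (i : Fin N) : ℕ := lam.1 i + (N - 1 - (i : ℕ))

theorem YN.shift_strictAnti (lam : YN N) : StrictAnti lam.shift := by
  intro i j hij
  have h1 := lam.2 hij.le
  have h2 : (i : ℕ) < j := hij
  have h3 := j.2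
  simp only [YN.shift]
  omega

theorem YN.sum_shift (lam : YN N) :
    ∑ i, lam.shift i = lam.size + ∑ i : Fin N, (N - 1 - (i : ℕ)) := by
  simp [YN.shift, YN.size, Finset.sum_add_distrib]

theorem YN.shift_injective : Function.Injective (YN.shift : YN N → Fin N → ℕ) := by
  intro a b h
  apply Subtype.ext
  funext i
  have := congrFun h i
  simpa [YN.shift] using this

theorem YN.exists_shift_eq {m : Fin N → ℕ} (hm : StrictAnti m) : ∃ lam : YN N, lam.shift = m := by
  -- Strict decrease in integers loses at least one per step. Comparison with the last coordinate
  -- gives $m_i\ge N-1-i$, so the truncated subtraction defining the partition is exact.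
  have key : ∀ (d : ℕ) (i j : Fin N), (j : ℕ) = i + d → m j + d ≤ m i := by
    intro d
    induction d with
    | zero =>
      intro i j h
      have : i = j := Fin.ext (by omega)
      simp [this]
    | succ d ih =>
      intro i j h
      have hj := j.2
      have h1 := ih i ⟨i + d, by omega⟩ rfl
      have h2 : m j < m ⟨i + d, by omega⟩ := hm (by rw [Fin.lt_def]; simp; omega)
      omega
  have hge : ∀ i : Fin N, N - 1 - (i : ℕ) ≤ m i := by
    intro i
    have hi := i.2
    have := key (N - 1 - i) i ⟨N - 1, by omega⟩ (by simp; omega)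
    omega
  refine ⟨⟨fun i => m i - (N - 1 - (i : ℕ)), fun i j hij => ?_⟩, ?_⟩
  · have hij' : (i : ℕ) ≤ j := hij
    have hj := j.2
    have := key (j - i) i j (by omega)
    have := hge i
    have := hge j
    simp only
    omega
  · funext i
    have := hge i
    simp only [YN.shift]
    omega

theorem exists_comp_perm_strictAnti {m : Fin N → ℕ} (hm : Function.Injective m) :
    ∃ e : Equiv.Perm (Fin N), StrictAnti (m ∘ e) := by
  refine ⟨Fin.revPerm.trans (Tuple.sort m), ?_⟩
  have h1 : StrictMono (m ∘ Tuple.sort m) :=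
    (Tuple.monotone_sort m).strictMono_of_injective (hm.comp (Tuple.sort m).injective)
  intro i j hij
  exact h1 (Fin.rev_lt_rev.2 hij)

theorem YN.finite_size (n : ℕ) : {lam : YN N | lam.size = n}.Finite := by
  have h : Set.Finite {f : Fin N → ℕ | ∀ i, f i ≤ n} := by
    have := Set.Finite.pi' (ι := Fin N) (κ := fun _ => ℕ) (t := fun _ => Set.Iic n)
      (fun _ => Set.finite_Iic n)
    simpa using this
  refine Set.Finite.of_finite_image (f := Subtype.val) (h.subset ?_) Subtype.val_injective.injOn
  rintro _ ⟨lam, hlam, rfl⟩ i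
  rw [← (hlam : lam.size = n)]
  exact Finset.single_le_sum (f := lam.1) (fun _ _ => Nat.zero_le _) (Finset.mem_univ i)

/-- The partitions of `n` with at most `N` parts. -/
def YN.ofSize (N n : ℕ) : Finset (YN N) := (YN.finite_size (N := N) n).toFinset

@[simp] theorem YN.mem_ofSize {n : ℕ} {lam : YN N} : lam ∈ YN.ofSize N n ↔ lam.size = n := by
  simp [YN.ofSize]

theorem altDet_eq_shift (lam : YN N) (x : Fin N → R) :
    altDet lam.1 x = Matrix.det (Matrix.of fun i j : Fin N => x j ^ lam.shift i) := rfl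

/-- The Cauchy–Binet expansion, in a fixed degree. -/
theorem sum_finsuppAntidiag_prod_pow_mul_det (x y : Fin N → R) (n : ℕ) :
    ∑ l ∈ Finset.finsuppAntidiag Finset.univ (n + ∑ i : Fin N, (N - 1 - (i : ℕ))),
        (∏ i, y i ^ l i) * Matrix.det (Matrix.of fun i j : Fin N => x j ^ l i)
      = ∑ lam ∈ YN.ofSize N n, altDet lam.1 x * altDet lam.1 y := by
  classical
  -- Leibniz expansion of the alternant in $y$; the sign of each permutation is absorbed by
  -- permuting the rows of the determinant in $x$.
  have hL : ∀ lam : YN N, altDet lam.1 x * altDet lam.1 y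
      = ∑ e : Equiv.Perm (Fin N), (∏ i, y i ^ lam.shift (e i)) *
          Matrix.det (Matrix.of fun i j : Fin N => x j ^ lam.shift (e i)) := by
    intro lam
    have h1 : ∀ e : Equiv.Perm (Fin N),
        Matrix.det (Matrix.of fun i j : Fin N => x j ^ lam.shift (e i))
          = ((Equiv.Perm.sign e : ℤ) : R) * altDet lam.1 x := by
      intro e
      rw [altDet_eq_shift, ← Matrix.det_permute]
      rfl
    simp_rw [h1]
    rw [altDet_eq_shift lam y, Matrix.det_apply', Finset.mul_sum]
    refine Finset.sum_congr rfl fun e _ => ?_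
    simp only [Matrix.of_apply]
    ring
  rw [Finset.sum_congr rfl fun lam _ => hL lam, ← Finset.sum_product', ]
  symm
  -- A repeated exponent gives two equal rows. Only injective exponent vectors survive, and each is
  -- `lam.shift ∘ e` for exactly one pair `(lam, e)`.
  have hzero : ∀ l : Fin N →₀ ℕ, ¬ Function.Injective l →
      Matrix.det (Matrix.of fun i j : Fin N => x j ^ l i) = 0 := by
    intro l hl
    simp only [Function.Injective, not_forall] at hl
    obtain ⟨i, j, h, hij⟩ := hl
    refine Matrix.det_zero_of_row_eq hij ?_
    funext k
    simp [h]
  rw [← Finset.sum_filter_of_ne (p := fun l : Fin N →₀ ℕ => Function.Injective l)]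
  swap
  · intro l _ h
    by_contra hl
    exact h (by rw [hzero l hl, mul_zero])
  refine Finset.sum_bij (fun p _ => Finsupp.equivFunOnFinite.symm (p.1.shift ∘ p.2)) ?_ ?_ ?_ ?_
  · rintro ⟨lam, e⟩ h
    simp only [Finset.mem_product, YN.mem_ofSize, Finset.mem_univ, and_true] at h
    simp only [Finset.mem_filter, Finset.mem_finsuppAntidiag, Finsupp.equivFunOnFinite_symm_apply_apply,
      Finset.subset_univ, and_true, Function.comp_apply, Finsupp.coe_equivFunOnFinite_symm]
    refine ⟨?_, lam.shift_strictAnti.injective.comp e.injective⟩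
    rw [Equiv.sum_comp e lam.shift, lam.sum_shift, h]
  · rintro ⟨lam, e⟩ _ ⟨lam', e'⟩ _ h
    have h' : lam.shift ∘ e = lam'.shift ∘ e' := Finsupp.equivFunOnFinite.symm.injective h
    have hr : Set.range lam.shift = Set.range lam'.shift := by
      rw [← e.surjective.range_comp lam.shift, h', e'.surjective.range_comp]
    have hs : lam.shift = lam'.shift := by
      have hm : ∀ l : YN N, StrictMono (l.shift ∘ Fin.rev) := fun l i j hij =>
        l.shift_strictAnti (Fin.rev_lt_rev.2 hij)
      have := (StrictMono.range_inj (hm lam) (hm lam')).1 (by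
        rw [Fin.rev_surjective.range_comp, Fin.rev_surjective.range_comp, hr])
      funext i
      simpa using congrFun this (Fin.rev i)
    have hl := YN.shift_injective hs
    subst hl
    refine Prod.ext rfl (Equiv.ext fun i => ?_)
    exact lam.shift_strictAnti.injective (congrFun h' i)
  · intro l hl
    simp only [Finset.mem_filter, Finset.mem_finsuppAntidiag, Finset.subset_univ, and_true] at hl
    obtain ⟨e, he⟩ := exists_comp_perm_strictAnti hl.2
    obtain ⟨lam, hlam⟩ := YN.exists_shift_eq he
    have hle : lam.shift ∘ e.symm = l := by
      rw [hlam]; funext i; simp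
    refine ⟨(lam, e.symm), ?_, ?_⟩
    · simp only [Finset.mem_product, YN.mem_ofSize, Finset.mem_univ, and_true]
      have h := lam.sum_shift
      rw [← Equiv.sum_comp e.symm lam.shift] at h
      have h2 : ∑ i, lam.shift (e.symm i) = ∑ i, l i :=
        Finset.sum_congr rfl fun i _ => congrFun hle i
      rw [h2, hl.1] at h
      omega
    · ext i
      exact congrFun hle i
  · rintro ⟨lam, e⟩ _
    rfl

end Cauchy

/-! ### The Cauchy identity for Schur polynomials -/

section CauchySeries

variable {R : Type*} [CommRing R] {N : ℕ}

/-- The geometric series `∑ a ^ k * t ^ k`. -/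
def geomSeries (a : R) : PowerSeries R := PowerSeries.mk fun k => a ^ k

theorem one_sub_mul_geomSeries (a : R) :
    (1 - PowerSeries.X * PowerSeries.C a) * geomSeries a = 1 := by
  ext n
  rw [sub_mul, one_mul, map_sub, mul_assoc]
  cases n with
  | zero => simp [geomSeries]
  | succ n =>
    rw [PowerSeries.coeff_succ_X_mul, PowerSeries.coeff_C_mul]
    simp [geomSeries, pow_succ', PowerSeries.coeff_one]

/-- The coefficient of `t ^ n` in `∏ (1 - t x_i y_j)⁻¹`. -/
def cauchyCoeff (x y : Fin N → R) (n : ℕ) : R :=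
  ∑ m ∈ Finset.finsuppAntidiag (Finset.univ : Finset (Fin N × Fin N)) n,
    ∏ p, (x p.1 * y p.2) ^ m p

theorem coeff_prod_geomSeries {ι : Type*} [Fintype ι] [DecidableEq ι] (a : ι → R) (n : ℕ) :
    PowerSeries.coeff n (∏ i, geomSeries (a i))
      = ∑ m ∈ Finset.finsuppAntidiag Finset.univ n, ∏ i, a i ^ m i := by
  rw [PowerSeries.coeff_prod]
  simp [geomSeries]

theorem map_cauchyCoeff {S : Type*} [CommRing S] (f : R →+* S) (x y : Fin N → R) (n : ℕ) :
    f (cauchyCoeff x y n) = cauchyCoeff (fun i => f (x i)) (fun i => f (y i)) n := by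
  simp [cauchyCoeff]

theorem altDet_X_mul (x : Fin N → R) :
    altDet (0 : Fin N → ℕ) (fun i => PowerSeries.X * PowerSeries.C (x i))
      = PowerSeries.X ^ (∑ i : Fin N, (N - 1 - (i : ℕ))) * PowerSeries.C (altDet 0 x) := by
  rw [altDet, altDet, RingHom.map_det, ← Finset.prod_pow_eq_pow_sum, ← Matrix.det_mul_column]
  congr 1
  ext1 i j
  simp [mul_pow]

theorem altDet_C (lam : Fin N → ℕ) (x : Fin N → R) :
    altDet lam (fun i => PowerSeries.C (x i)) = PowerSeries.C (altDet lam x) := by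
  rw [altDet, altDet, RingHom.map_det]
  congr 1
  ext1 i j
  simp

/-- This is the Cauchy determinant over the power series ring at the points $t x_i$ and $y_j$, with
column $j$ multiplied by $\prod_l(1-t x_l y_j)^{-1}$. The power of $t$ in front comes from the
alternant of the $t x_i$. -/
theorem det_geomSeries [IsDomain R] (x y : Fin N → R) (hx : altDet (0 : Fin N → ℕ) x ≠ 0) :
    Matrix.det (Matrix.of fun i j : Fin N => geomSeries (x i * y j))
      = PowerSeries.X ^ (∑ i : Fin N, (N - 1 - (i : ℕ))) *
        (PowerSeries.C (altDet 0 x * altDet 0 y) *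
          ∏ p : Fin N × Fin N, geomSeries (x p.1 * y p.2)) := by
  have h1 : altDet (0 : Fin N → ℕ) (fun i => PowerSeries.X * PowerSeries.C (x i)) ≠ 0 := by
    rw [altDet_X_mul]
    refine mul_ne_zero (pow_ne_zero _ PowerSeries.X_ne_zero) ?_
    rwa [Ne, map_eq_zero_iff _ PowerSeries.C_injective]
  have h2 := det_prod_one_sub_mul (fun i => PowerSeries.X * PowerSeries.C (x i))
    (fun i => PowerSeries.C (y i)) h1
  rw [altDet_X_mul, altDet_C] at h2
  have h3 : (Matrix.of fun i j : Fin N => geomSeries (x i * y j))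
      = Matrix.of fun i j : Fin N => (∏ l, geomSeries (x l * y j)) *
        (Matrix.of fun i j : Fin N => ∏ l ∈ Finset.univ.erase i,
          (1 - PowerSeries.X * PowerSeries.C (x l) * PowerSeries.C (y j))) i j := by
    ext1 i j
    simp only [Matrix.of_apply]
    rw [← Finset.mul_prod_erase _ _ (Finset.mem_univ i), mul_assoc, ← Finset.prod_mul_distrib,
      Finset.prod_eq_one, mul_one]
    intro l _
    rw [mul_assoc PowerSeries.X, ← map_mul, mul_comm, one_sub_mul_geomSeries]
  rw [h3, Matrix.det_mul_row, h2, Fintype.prod_prod_type_right]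
  simp only [map_mul]
  ring

/-- Two evaluations of one coefficient of $\det[(1-t x_i y_j)^{-1}]$: the Leibniz formula gives the
Cauchy–Binet sum, the Cauchy determinant gives the product. -/
theorem sum_altDet_mul_altDet [IsDomain R] (x y : Fin N → R)
    (hx : altDet (0 : Fin N → ℕ) x ≠ 0) (n : ℕ) :
    ∑ lam ∈ YN.ofSize N n, altDet lam.1 x * altDet lam.1 y
      = altDet 0 x * altDet 0 y * cauchyCoeff x y n := by
  have h := congrArg (PowerSeries.coeff (n + ∑ i : Fin N, (N - 1 - (i : ℕ)))) (det_geomSeries x y hx)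
  rw [PowerSeries.coeff_X_pow_mul, PowerSeries.coeff_C_mul, coeff_prod_geomSeries] at h
  rw [cauchyCoeff, ← h, ← sum_finsuppAntidiag_prod_pow_mul_det, Matrix.det_apply', map_sum]
  have h2 : ∀ e : Equiv.Perm (Fin N),
      PowerSeries.coeff (n + ∑ i : Fin N, (N - 1 - (i : ℕ)))
        (((Equiv.Perm.sign e : ℤ) : PowerSeries R) *
          ∏ i, Matrix.of (fun i j : Fin N => geomSeries (x i * y j)) (e i) i)
      = ∑ l ∈ Finset.finsuppAntidiag Finset.univ (n + ∑ i : Fin N, (N - 1 - (i : ℕ))),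
        ((Equiv.Perm.sign e : ℤ) : R) * ∏ i, (x (e i) * y i) ^ l i := by
    intro e
    have : ((Equiv.Perm.sign e : ℤ) : PowerSeries R)
        = PowerSeries.C ((Equiv.Perm.sign e : ℤ) : R) := by simp
    rw [this, PowerSeries.coeff_C_mul, ← Finset.mul_sum, ← coeff_prod_geomSeries]
    rfl
  rw [Finset.sum_congr rfl fun e _ => h2 e, Finset.sum_comm]
  refine Finset.sum_congr rfl fun l _ => ?_
  rw [← Matrix.det_transpose, Matrix.det_apply', Finset.mul_sum]
  refine Finset.sum_congr rfl fun e _ => ?_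
  simp only [Matrix.transpose_apply, Matrix.of_apply, mul_pow, Finset.prod_mul_distrib]
  ring

theorem rename_alternant_eq_altDet {σ : Type*} (lam : Fin N → ℕ) (f : Fin N → σ) :
    MvPolynomial.rename f (alternant lam)
      = altDet lam (fun i => (MvPolynomial.X (f i) : MvPolynomial σ ℂ)) := by
  rw [alternant, altDet, AlgHom.map_det]
  congr 1
  ext1 i j
  simp

/-- The Cauchy identity in degree `n`, for polynomials. -/
theorem sum_rename_schurPoly (N n : ℕ) :
    ∑ lam ∈ YN.ofSize N n, MvPolynomial.rename (Sum.inl : Fin N → Fin N ⊕ Fin N) (schurPoly lam) *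
        MvPolynomial.rename (Sum.inr : Fin N → Fin N ⊕ Fin N) (schurPoly lam)
      = cauchyCoeff (fun i => (MvPolynomial.X (Sum.inl i) : MvPolynomial (Fin N ⊕ Fin N) ℂ))
        (fun i => MvPolynomial.X (Sum.inr i)) n := by
  -- For independent variables the alternants are nonzero and can be cancelled. Points with repeated
  -- coordinates are reached by specializing afterwards.
  have hne : ∀ f : Fin N → Fin N ⊕ Fin N, Function.Injective f →
      altDet (0 : Fin N → ℕ) (fun i => (MvPolynomial.X (f i) : MvPolynomial (Fin N ⊕ Fin N) ℂ)) ≠ 0 := by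
    intro f hf
    rw [← rename_alternant_eq_altDet, Ne,
      map_eq_zero_iff _ (MvPolynomial.rename_injective f hf)]
    exact alternant_zero_ne_zero N
  have hl := hne _ Sum.inl_injective
  have hr := hne _ Sum.inr_injective
  refine mul_left_cancel₀ (mul_ne_zero hl hr) ?_
  rw [← sum_altDet_mul_altDet _ _ hl, Finset.mul_sum]
  refine Finset.sum_congr rfl fun lam _ => ?_
  rw [← rename_alternant_eq_altDet, ← rename_alternant_eq_altDet, ← rename_alternant_eq_altDet,
    ← rename_alternant_eq_altDet, ← alternant_zero_mul_schurPoly lam, map_mul, map_mul]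
  ring

/-- The Cauchy identity in degree `n`. -/
theorem sum_eval_schurPoly_mul (x y : Fin N → ℂ) (n : ℕ) :
    ∑ lam ∈ YN.ofSize N n,
        MvPolynomial.eval x (schurPoly lam) * MvPolynomial.eval y (schurPoly lam)
      = cauchyCoeff x y n := by
  have h := congrArg (MvPolynomial.eval (Sum.elim x y)) (sum_rename_schurPoly N n)
  rw [map_cauchyCoeff, map_sum] at h
  simpa [MvPolynomial.eval_rename, Sum.elim_comp_inl, Sum.elim_comp_inr] using h

/-- Alternants have integer coefficients, so they and their quotient are fixed by conjugation of
coefficients. -/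
theorem eval_star_schurPoly (lam : YN N) (x : Fin N → ℂ) :
    MvPolynomial.eval (fun i => starRingEnd ℂ (x i)) (schurPoly lam)
      = starRingEnd ℂ (MvPolynomial.eval x (schurPoly lam)) := by
  have hmap : ∀ mu : Fin N → ℕ,
      MvPolynomial.map (starRingEnd ℂ) (alternant mu) = alternant mu := by
    intro mu
    rw [alternant, RingHom.map_det]
    congr 1
    ext1 i j
    simp
  have h : MvPolynomial.map (starRingEnd ℂ) (schurPoly lam) = schurPoly lam := by
    refine mul_left_cancel₀ (alternant_zero_ne_zero N) ?_
    conv_lhs => rw [← hmap 0]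
    rw [← map_mul, alternant_zero_mul_schurPoly, hmap]
  conv_lhs => rw [← h]
  rw [MvPolynomial.eval_map]
  exact (MvPolynomial.eval₂_comp_left (starRingEnd ℂ) (RingHom.id ℂ) x (schurPoly lam)).symm

theorem sum_norm_sq_eval_schurPoly (x : Fin N → ℂ) (n : ℕ) :
    ((∑ lam ∈ YN.ofSize N n, ‖MvPolynomial.eval x (schurPoly lam)‖ ^ 2 : ℝ) : ℂ)
      = cauchyCoeff x (fun i => starRingEnd ℂ (x i)) n := by
  rw [← sum_eval_schurPoly_mul]
  push_cast
  refine Finset.sum_congr rfl fun lam _ => ?_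
  rw [eval_star_schurPoly, Complex.mul_conj, Complex.normSq_eq_norm_sq]
  push_cast
  rfl

end CauchySeries

/-! ### Diagonalization of unitary matrices -/

section Diagonalization

variable {N : ℕ}

/-- Multiplication by a matrix, as an operator on Euclidean space. -/
abbrev euclideanEnd (A : Matrix (Fin N) (Fin N) ℂ) : Module.End ℂ (EuclideanSpace ℂ (Fin N)) :=
  Matrix.toEuclideanLin A

theorem euclideanEnd_apply_apply (A : Matrix (Fin N) (Fin N) ℂ) (v : EuclideanSpace ℂ (Fin N))
    (i : Fin N) : euclideanEnd A v i = ∑ j, A i j * v j := rfl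

theorem inner_euclideanEnd (U : UN N) (x y : EuclideanSpace ℂ (Fin N)) :
    inner ℂ (euclideanEnd U.1 x) (euclideanEnd U.1 y) = inner ℂ x y := by
  rw [← LinearMap.adjoint_inner_right, euclideanEnd, ← Matrix.toEuclideanLin_conjTranspose_eq_adjoint]
  congr 1
  have h : U.1.conjTranspose * U.1 = 1 := Matrix.mem_unitaryGroup_iff'.1 U.2
  have h2 : (U.1.conjTranspose * U.1).toEuclideanLin y = y := by
    rw [h]
    ext i
    simp [Matrix.toEuclideanLin]
  refine Eq.trans ?_ h2
  ext i
  simp [Matrix.toEuclideanLin, Matrix.mulVec_mulVec]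

/-- The orthogonal complement of an invariant subspace $p$ is invariant: $U$ is injective, hence
surjective, on the finite-dimensional $p$, so $y\in p$ is $Uz$ with $z\in p$, and $\langle
y,Ux\rangle=\langle z,x\rangle=0$ for $x\perp p$. -/
theorem isSemisimple_euclideanEnd (U : UN N) : (euclideanEnd U.1).IsSemisimple := by
  rw [Module.End.isSemisimple_iff]
  intro p hp
  refine ⟨pᗮ, ?_, Submodule.isCompl_orthogonal p⟩
  have hinj : Function.Injective ((euclideanEnd U.1).restrict (fun x hx => hp hx) : p →ₗ[ℂ] p) := by
    rw [injective_iff_map_eq_zero]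
    intro x hx
    have h := inner_euclideanEnd U (x : EuclideanSpace ℂ (Fin N)) x
    have hx' : euclideanEnd U.1 (x : EuclideanSpace ℂ (Fin N)) = 0 := congrArg Subtype.val hx
    rw [hx', inner_zero_left] at h
    exact Subtype.ext (inner_self_eq_zero.1 h.symm)
  intro x hx
  rw [Submodule.mem_comap, Submodule.mem_orthogonal]
  intro y hy
  obtain ⟨z, hz⟩ := (LinearMap.injective_iff_surjective.1 hinj) ⟨y, hy⟩
  have hz' : euclideanEnd U.1 (z : EuclideanSpace ℂ (Fin N)) = y := congrArg Subtype.val hz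
  rw [← hz', inner_euclideanEnd]
  exact (Submodule.mem_orthogonal _ _).1 hx _ z.2

theorem exists_eigenbasis (U : UN N) :
    ∃ (b : Module.Basis (Fin N) ℂ (EuclideanSpace ℂ (Fin N))) (u : Fin N → ℂ),
      ∀ j, euclideanEnd U.1 (b j) = u j • b j := by
  let s : Set (EuclideanSpace ℂ (Fin N)) := {v | ∃ c : ℂ, euclideanEnd U.1 v = c • v}
  have hs : ⊤ ≤ Submodule.span ℂ s := by
    rw [← (isSemisimple_euclideanEnd U).iSup_eigenspace_eq_top]
    refine iSup_le fun c v hv => Submodule.subset_span ⟨c, ?_⟩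
    exact Module.End.mem_eigenspace_iff.1 hv
  let b := Module.Basis.ofSpan hs
  have : Finite _ := Module.Finite.finite_basis b
  have : Fintype ((linearIndepOn_empty ℂ id).extend (Set.empty_subset s)) := Fintype.ofFinite _
  have hcard := Module.finrank_eq_card_basis b
  rw [finrank_euclideanSpace_fin] at hcard
  let e := Fintype.equivFinOfCardEq hcard.symm
  have hb : ∀ j, ∃ c : ℂ, euclideanEnd U.1 (b.reindex e j) = c • b.reindex e j := by
    intro j
    rw [Module.Basis.reindex_apply, Module.Basis.ofSpan_apply_self]
    exact (linearIndepOn_empty ℂ id).extend_subset (Set.empty_subset s) (e.symm j).2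
  choose u hu using hb
  exact ⟨b.reindex e, u, hu⟩

/-- Unitary matrices are diagonalizable, with eigenvalues on the unit circle. -/
theorem exists_diagonalization (U : UN N) :
    ∃ (u : Fin N → ℂ) (V W : Matrix (Fin N) (Fin N) ℂ), V * W = 1 ∧ W * V = 1 ∧
      (∀ i, ‖u i‖ = 1) ∧ U.1 = V * Matrix.diagonal u * W ∧
      star U.1 = V * Matrix.diagonal (fun i => starRingEnd ℂ (u i)) * W := by
  obtain ⟨b, u, hu⟩ := exists_eigenbasis U
  let e : Module.Basis (Fin N) ℂ (EuclideanSpace ℂ (Fin N)) :=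
    (EuclideanSpace.basisFun (Fin N) ℂ).toBasis
  let V := e.toMatrix b
  let W := b.toMatrix e
  have hVW : V * W = 1 := Module.Basis.toMatrix_mul_toMatrix_flip _ _
  have hWV : W * V = 1 := Module.Basis.toMatrix_mul_toMatrix_flip _ _
  have hV : ∀ i j, V i j = b j i := fun i j => by simp [V, e, Module.Basis.toMatrix_apply]
  have hnorm : ∀ i, ‖u i‖ = 1 := by
    intro i
    have h := inner_euclideanEnd U (b i) (b i)
    rw [hu i, inner_smul_left, inner_smul_right, ← mul_assoc] at h
    have h2 := mul_right_cancel₀ (inner_self_ne_zero.2 (b.ne_zero i)) (h.trans (one_mul _).symm)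
    rw [Complex.conj_mul', ] at h2
    have h3 : ‖u i‖ ^ 2 = 1 := by exact_mod_cast h2
    exact (pow_eq_one_iff_of_nonneg (norm_nonneg _) two_ne_zero).1 h3
  have hUV : U.1 * V = V * Matrix.diagonal u := by
    ext i j
    rw [Matrix.mul_diagonal, Matrix.mul_apply, hV, mul_comm]
    have h := congrArg (fun v : EuclideanSpace ℂ (Fin N) => v i) (hu j)
    simp only [euclideanEnd_apply_apply, PiLp.smul_apply, smul_eq_mul] at h
    rw [← h]
    exact Finset.sum_congr rfl fun k _ => by rw [hV]
  have hU : U.1 = V * Matrix.diagonal u * W := by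
    rw [← hUV, mul_assoc, hVW, mul_one]
  have hd : Matrix.diagonal u * Matrix.diagonal (fun i => starRingEnd ℂ (u i)) = 1 := by
    rw [Matrix.diagonal_mul_diagonal, ← Matrix.diagonal_one]
    congr 1
    funext i
    rw [Complex.mul_conj', hnorm i]
    simp
  refine ⟨u, V, W, hVW, hWV, hnorm, hU, ?_⟩
  -- The conjugate-diagonal matrix in the same basis is a right inverse of $U$, hence equals $U^*$.
  -- No orthonormality of the eigenbasis is needed.
  have h1 : U.1 * (V * Matrix.diagonal (fun i => starRingEnd ℂ (u i)) * W) = 1 := by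
    rw [mul_assoc V, ← mul_assoc U.1, hUV, mul_assoc V, ← mul_assoc (Matrix.diagonal u), hd, one_mul,
      hVW]
  calc star U.1 = star U.1 * (U.1 * (V * Matrix.diagonal (fun i => starRingEnd ℂ (u i)) * W)) := by
        rw [h1, mul_one]
    _ = _ := by rw [← mul_assoc, Matrix.mem_unitaryGroup_iff'.1 U.2, one_mul]

theorem conj_diagonal_pow {V W : Matrix (Fin N) (Fin N) ℂ} (hVW : V * W = 1) (hWV : W * V = 1)
    (u : Fin N → ℂ) (k : ℕ) :
    (V * Matrix.diagonal u * W) ^ k = V * Matrix.diagonal (fun i => u i ^ k) * W := by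
  induction k with
  | zero => simp [hVW]
  | succ k ih =>
    have h : Matrix.diagonal (fun i => u i ^ (k + 1))
        = Matrix.diagonal (fun i => u i ^ k) * Matrix.diagonal u := by
      rw [Matrix.diagonal_mul_diagonal]; rfl
    rw [pow_succ, ih, h]
    simp only [mul_assoc]
    rw [← mul_assoc W V, hWV, one_mul]

theorem trace_conj_diagonal {V W : Matrix (Fin N) (Fin N) ℂ} (hWV : W * V = 1) (u : Fin N → ℂ) :
    (V * Matrix.diagonal u * W).trace = ∑ i, u i := by
  rw [Matrix.trace_mul_cycle, hWV, one_mul, Matrix.trace_diagonal]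

theorem roots_charpoly_conj_diagonal {V W : Matrix (Fin N) (Fin N) ℂ} (hWV : W * V = 1)
    (u : Fin N → ℂ) :
    (V * Matrix.diagonal u * W).charpoly.roots = Finset.univ.val.map u := by
  rw [Matrix.charpoly_mul_comm, ← mul_assoc, hWV, one_mul, Matrix.charpoly_diagonal]
  exact Polynomial.roots_multiset_prod_X_sub_C (Finset.univ.val.map u) |> fun h => by
    rw [← h, Multiset.map_map]; rfl

end Diagonalization

/-! ### Symmetric powers as linear substitutions in forms -/

section SymmetricPower

variable {σ : Type*} [Fintype σ]

/-- The linear substitution `X s ↦ ∑ t, S s t * X t`. -/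
def linearSubst (S : Matrix σ σ ℂ) : MvPolynomial σ ℂ →ₐ[ℂ] MvPolynomial σ ℂ :=
  MvPolynomial.aeval fun s => ∑ t, MvPolynomial.C (S s t) * MvPolynomial.X t

@[simp] theorem linearSubst_X (S : Matrix σ σ ℂ) (s : σ) :
    linearSubst S (MvPolynomial.X s) = ∑ t, MvPolynomial.C (S s t) * MvPolynomial.X t := by
  simp [linearSubst]

theorem linearSubst_linearSubst (S T : Matrix σ σ ℂ) (p : MvPolynomial σ ℂ) :
    linearSubst S (linearSubst T p) = linearSubst (T * S) p := by
  suffices h : (linearSubst S).comp (linearSubst T) = linearSubst (T * S) from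
    DFunLike.congr_fun h p
  refine MvPolynomial.algHom_ext fun s => ?_
  have hC : ∀ c : ℂ, linearSubst S (MvPolynomial.C c) = MvPolynomial.C c := fun c =>
    (linearSubst S).commutes c
  simp only [AlgHom.comp_apply, linearSubst_X, map_sum, map_mul, hC, Finset.mul_sum]
  rw [Finset.sum_comm]
  refine Finset.sum_congr rfl fun t _ => ?_
  rw [Matrix.mul_apply, map_sum, Finset.sum_mul]
  exact Finset.sum_congr rfl fun r _ => by rw [map_mul, mul_assoc]

theorem linearSubst_one [DecidableEq σ] (p : MvPolynomial σ ℂ) : linearSubst (1 : Matrix σ σ ℂ) p = p := by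
  have h : linearSubst (1 : Matrix σ σ ℂ) = AlgHom.id ℂ _ := by
    refine MvPolynomial.algHom_ext fun s => ?_
    simp [Matrix.one_apply, apply_ite, ite_mul]
  rw [h]
  rfl

theorem eval_linearSubst (S : Matrix σ σ ℂ) (x : σ → ℂ) (p : MvPolynomial σ ℂ) :
    MvPolynomial.eval x (linearSubst S p) = MvPolynomial.eval (S.mulVec x) p := by
  rw [linearSubst, MvPolynomial.aeval_def, MvPolynomial.eval_eval₂]
  rw [MvPolynomial.eval₂_eq_eval_map]
  congr 1
  · congr 1
    funext s
    simp [Matrix.mulVec, dotProduct]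
  · convert MvPolynomial.map_id p
    ext c
    simp

theorem isHomogeneous_linearSubst (S : Matrix σ σ ℂ) {p : MvPolynomial σ ℂ} {n : ℕ}
    (hp : p.IsHomogeneous n) : (linearSubst S p).IsHomogeneous n := by
  have h := hp.aeval (fun s => ∑ t, MvPolynomial.C (S s t) * MvPolynomial.X t) (n := 1)
    (fun s => MvPolynomial.IsHomogeneous.sum _ _ _ fun t _ => by
      simpa using (MvPolynomial.isHomogeneous_C σ (S s t)).mul (MvPolynomial.isHomogeneous_X ℂ t))
  rwa [one_mul] at h

variable [DecidableEq σ]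

/-- Exponents of the monomials of degree `n`. -/
abbrev MonomialIdx (σ : Type*) [Fintype σ] [DecidableEq σ] (n : ℕ) : Type _ :=
  {m : σ →₀ ℕ // m ∈ Finset.finsuppAntidiag (Finset.univ : Finset σ) n}

theorem MonomialIdx.degree_eq {n : ℕ} (m : MonomialIdx σ n) : m.1.degree = n := by
  have := (Finset.mem_finsuppAntidiag.1 m.2).1
  rw [Finsupp.degree_eq_sum]
  exact this

/-- The form of degree `n` with a given vector of coefficients. -/
def formOfCoeffs (n : ℕ) : (MonomialIdx σ n → ℂ) →ₗ[ℂ] MvPolynomial σ ℂ :=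
  Fintype.linearCombination ℂ fun m : MonomialIdx σ n => MvPolynomial.monomial m.1 (1 : ℂ)

theorem formOfCoeffs_apply {n : ℕ} (v : MonomialIdx σ n → ℂ) :
    formOfCoeffs n v = ∑ m, MvPolynomial.monomial m.1 (v m) := by
  simp [formOfCoeffs, Fintype.linearCombination_apply, MvPolynomial.smul_monomial]

theorem coeff_formOfCoeffs {n : ℕ} (v : MonomialIdx σ n → ℂ) (m : MonomialIdx σ n) :
    MvPolynomial.coeff m.1 (formOfCoeffs n v) = v m := by
  rw [formOfCoeffs_apply, MvPolynomial.coeff_sum, Finset.sum_eq_single m]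
  · simp
  · intro b _ hb
    rw [MvPolynomial.coeff_monomial, if_neg fun h => hb (Subtype.ext h)]
  · simp

theorem formOfCoeffs_injective (n : ℕ) :
    Function.Injective (formOfCoeffs n : (MonomialIdx σ n → ℂ) →ₗ[ℂ] MvPolynomial σ ℂ) := by
  intro v w h
  funext m
  rw [← coeff_formOfCoeffs v, h, coeff_formOfCoeffs]

theorem isHomogeneous_formOfCoeffs {n : ℕ} (v : MonomialIdx σ n → ℂ) :
    (formOfCoeffs n v).IsHomogeneous n := by
  rw [formOfCoeffs_apply]
  exact MvPolynomial.IsHomogeneous.sum _ _ _ fun m _ =>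
    MvPolynomial.isHomogeneous_monomial _ m.degree_eq

theorem formOfCoeffs_coeff {n : ℕ} {p : MvPolynomial σ ℂ} (hp : p.IsHomogeneous n) :
    formOfCoeffs n (fun m : MonomialIdx σ n => MvPolynomial.coeff m.1 p) = p := by
  ext a
  by_cases ha : a ∈ Finset.finsuppAntidiag (Finset.univ : Finset σ) n
  · exact coeff_formOfCoeffs (fun m : MonomialIdx σ n => MvPolynomial.coeff m.1 p) ⟨a, ha⟩
  · have hd : a.degree ≠ n := by
      intro h
      apply ha
      rw [Finset.mem_finsuppAntidiag]
      rw [Finsupp.degree_eq_sum] at h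
      exact ⟨h, Finset.subset_univ _⟩
    rw [hp.coeff_eq_zero hd, (isHomogeneous_formOfCoeffs _).coeff_eq_zero hd]

/-- The matrix of a linear substitution on the forms of degree `n`. -/
def symPow (n : ℕ) (S : Matrix σ σ ℂ) : Matrix (MonomialIdx σ n) (MonomialIdx σ n) ℂ :=
  Matrix.of fun a b => MvPolynomial.coeff a.1 (linearSubst S (MvPolynomial.monomial b.1 1))

theorem linearSubst_formOfCoeffs (n : ℕ) (S : Matrix σ σ ℂ) (v : MonomialIdx σ n → ℂ) :
    linearSubst S (formOfCoeffs n v) = formOfCoeffs n ((symPow n S).mulVec v) := by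
  rw [← formOfCoeffs_coeff (isHomogeneous_linearSubst S (isHomogeneous_formOfCoeffs v))]
  congr 1
  funext a
  rw [formOfCoeffs_apply, map_sum, MvPolynomial.coeff_sum]
  refine Finset.sum_congr rfl fun b _ => ?_
  have h : MvPolynomial.monomial b.1 (v b) = v b • MvPolynomial.monomial b.1 (1 : ℂ) := by
    simp [MvPolynomial.smul_monomial]
  rw [h, map_smul, MvPolynomial.coeff_smul, smul_eq_mul, mul_comm]
  rfl

theorem symPow_mul (n : ℕ) (S T : Matrix σ σ ℂ) :
    symPow n (T * S) = symPow n S * symPow n T := by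
  refine Matrix.ext_of_mulVec_single fun b => ?_
  apply formOfCoeffs_injective
  rw [← linearSubst_formOfCoeffs, ← linearSubst_linearSubst, linearSubst_formOfCoeffs,
    linearSubst_formOfCoeffs, Matrix.mulVec_mulVec]

theorem symPow_one (n : ℕ) : symPow n (1 : Matrix σ σ ℂ) = 1 := by
  refine Matrix.ext_of_mulVec_single fun b => ?_
  apply formOfCoeffs_injective
  rw [← linearSubst_formOfCoeffs, linearSubst_one, Matrix.one_mulVec]

/-- Monomials are eigenvectors of a diagonal substitution, each with its own value at $d$ as
eigenvalue. -/
theorem trace_symPow_diagonal (n : ℕ) (d : σ → ℂ) :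
    (symPow n (Matrix.diagonal d)).trace
      = ∑ m ∈ Finset.finsuppAntidiag (Finset.univ : Finset σ) n, ∏ s, d s ^ m s := by
  rw [Finset.sum_subtype (p := fun m => m ∈ Finset.finsuppAntidiag (Finset.univ : Finset σ) n) _
    (fun _ => Iff.rfl) fun m => ∏ s, d s ^ m s, Matrix.trace]
  refine Fintype.sum_congr _ _ fun m => ?_
  have hX : ∀ s, linearSubst (Matrix.diagonal d) (MvPolynomial.X s)
      = MvPolynomial.C (d s) * MvPolynomial.X s := by
    intro s
    rw [linearSubst_X, Finset.sum_eq_single s]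
    · simp
    · intro t _ ht
      simp [Matrix.diagonal_apply_ne _ ht.symm]
    · simp
  have h : linearSubst (Matrix.diagonal d) (MvPolynomial.monomial m.1 1)
      = MvPolynomial.monomial m.1 (∏ s, d s ^ m.1 s) := by
    have hprod : MvPolynomial.monomial m.1 (1 : ℂ)
        = ∏ s, (MvPolynomial.X s : MvPolynomial σ ℂ) ^ m.1 s := by
      rw [MvPolynomial.monomial_eq, Finsupp.prod_fintype _ _ (by simp)]
      simp
    rw [hprod, map_prod]
    simp only [map_pow, hX, mul_pow, Finset.prod_mul_distrib]
    rw [← hprod]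
    simp only [← map_pow, ← map_prod]
    rw [MvPolynomial.C_mul_monomial, mul_one]
  rw [Matrix.diag_apply, symPow, Matrix.of_apply, h, MvPolynomial.coeff_monomial, if_pos rfl]

/-- The trace of a symmetric power is the complete homogeneous polynomial in the eigenvalues. -/
theorem trace_symPow_conj_diagonal (n : ℕ) {V W : Matrix σ σ ℂ} (hWV : W * V = 1) (d : σ → ℂ) :
    (symPow n (V * Matrix.diagonal d * W)).trace
      = ∑ m ∈ Finset.finsuppAntidiag (Finset.univ : Finset σ) n, ∏ s, d s ^ m s := by
  rw [symPow_mul, symPow_mul, ← mul_assoc, Matrix.trace_mul_cycle, ← symPow_mul, hWV, symPow_one,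
    one_mul, trace_symPow_diagonal]

end SymmetricPower

/-! ### Averaging a character over a compact group -/

section Averaging

variable {G : Type*} [Group G] [TopologicalSpace G] [IsTopologicalGroup G] [CompactSpace G]
  [MeasurableSpace G] [BorelSpace G] (μ : Measure G) [IsProbabilityMeasure μ]
  [μ.IsMulLeftInvariant]

/-- The mean of the character of a representation of a compact group is the dimension of the
space of invariants. -/
theorem integral_trace_eq_finrank_invariants {ι : Type*} [Fintype ι] [DecidableEq ι]
    (ρ : G → Matrix ι ι ℂ) (hρ : Continuous ρ) (hmul : ∀ g h, ρ (g * h) = ρ g * ρ h)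
    (I : Submodule ℂ (ι → ℂ)) (hI : ∀ v, v ∈ I ↔ ∀ g, (ρ g).mulVec v = v) :
    ∫ g, (ρ g).trace ∂μ = Module.finrank ℂ I := by
  have hint : ∀ a b, Integrable (fun g => ρ g a b) μ := fun a b =>
    (by fun_prop : Continuous fun g => ρ g a b).integrable_of_hasCompactSupport
      (HasCompactSupport.of_compactSpace _)
  -- The mean `P` of `ρ` is a projection onto `I`: left invariance gives `ρ g * P = P`, so the range
  -- lies in `I`, and `P` fixes `I` pointwise. The trace of a projection is its rank.
  let P : Matrix ι ι ℂ := Matrix.of fun a b => ∫ g, ρ g a b ∂μ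
  have hfix : ∀ g, ρ g * P = P := by
    intro g
    ext a b
    rw [Matrix.mul_apply]
    simp only [P, Matrix.of_apply, ← integral_const_mul]
    rw [← integral_finsetSum _ fun c _ => (hint c b).const_mul _,
      ← integral_mul_left_eq_self (fun h => ρ h a b) g]
    simp only [hmul, Matrix.mul_apply]
  have happly : ∀ v, (∀ g, (ρ g).mulVec v = v) → P.mulVec v = v := by
    intro v hv
    funext a
    simp only [Matrix.mulVec, dotProduct, P, Matrix.of_apply, ← integral_mul_const]
    rw [← integral_finsetSum _ fun c _ => (hint a c).mul_const _]
    have : ∀ g, ∑ c, ρ g a c * v c = v a := fun g => congrFun (hv g) a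
    simp [this]
  have hproj : LinearMap.IsProj I (Matrix.toLin' P) := by
    constructor
    · intro v
      rw [hI]
      intro g
      rw [Matrix.toLin'_apply, Matrix.mulVec_mulVec, hfix]
    · intro v hv
      exact happly v ((hI v).1 hv)
  have htr := hproj.trace
  rw [Matrix.trace_toLin'_eq] at htr
  rw [← htr]
  simp only [Matrix.trace, Matrix.diag_apply, P, Matrix.of_apply]
  exact integral_finsetSum _ fun c _ => hint c c

end Averaging

/-! ### Weighted degrees under substitution -/

section WeightedHomogeneous

variable {σ τ : Type*} [Fintype τ]

theorem isHomogeneous_aeval_monomial (w : τ → ℕ) (g : τ → MvPolynomial σ ℂ)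
    (hg : ∀ i, (g i).IsHomogeneous (w i)) (a : τ →₀ ℕ) (c : ℂ) :
    (MvPolynomial.aeval g (MvPolynomial.monomial a c)).IsHomogeneous (Finsupp.weight w a) := by
  rw [MvPolynomial.aeval_monomial, Finsupp.prod_fintype _ _ (by simp), Finsupp.weight_apply,
    Finsupp.sum_fintype _ _ (by simp), ← zero_add (∑ i, a i • w i)]
  refine (MvPolynomial.isHomogeneous_C σ c).mul ?_
  refine MvPolynomial.IsHomogeneous.prod _ _ _ fun i _ => ?_
  rw [smul_eq_mul, mul_comm]
  exact (hg i).pow _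

/-- Needed to replace a polynomial expressing a form of degree $n$ through generators by its
component of weight $n$. -/
theorem homogeneousComponent_aeval (w : τ → ℕ) (g : τ → MvPolynomial σ ℂ)
    (hg : ∀ i, (g i).IsHomogeneous (w i)) (n : ℕ) (b : MvPolynomial τ ℂ) :
    MvPolynomial.homogeneousComponent n (MvPolynomial.aeval g b)
      = MvPolynomial.aeval g (MvPolynomial.weightedHomogeneousComponent w n b) := by
  induction b using MvPolynomial.induction_on' with
  | monomial a c =>
    rw [MvPolynomial.homogeneousComponent_of_mem (isHomogeneous_aeval_monomial w g hg a c),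
      MvPolynomial.weightedHomogeneousComponent_of_mem
        (MvPolynomial.isWeightedHomogeneous_monomial w a c rfl)]
    split_ifs <;> simp
  | add p q hp hq => simp only [map_add, hp, hq]

theorem isHomogeneous_aeval_of_isWeightedHomogeneous (w : τ → ℕ) (g : τ → MvPolynomial σ ℂ)
    (hg : ∀ i, (g i).IsHomogeneous (w i)) {n : ℕ} {b : MvPolynomial τ ℂ}
    (hb : b.IsWeightedHomogeneous w n) : (MvPolynomial.aeval g b).IsHomogeneous n := by
  rw [← MvPolynomial.weightedHomogeneousComponent_eq_self hb, ← homogeneousComponent_aeval w g hg]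
  exact MvPolynomial.homogeneousComponent_isHomogeneous _ _

end WeightedHomogeneous

/-! ### Conjugation-invariant polynomial functions on matrices -/

section Conjugation

open scoped Kronecker

variable {N : ℕ}

/-- The action `X ↦ Uᵀ X Ū` on `N × N` matrices. -/
def conjMatrix (U : UN N) : Matrix (Fin N × Fin N) (Fin N × Fin N) ℂ :=
  U.1.transpose ⊗ₖ star U.1

/-- The order is reversed here and once more in `symPow_mul`, so `symPow n (conjMatrix U)` is
multiplicative in `U`. -/
theorem conjMatrix_mul (U V : UN N) : conjMatrix (U * V) = conjMatrix V * conjMatrix U := by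
  rw [conjMatrix, conjMatrix, conjMatrix, ← Matrix.mul_kronecker_mul]
  simp [Matrix.transpose_mul]

theorem conjMatrix_mulVec (U : UN N) (A : Matrix (Fin N) (Fin N) ℂ) :
    (conjMatrix U).mulVec (fun p => A p.1 p.2)
      = fun p => (U.1.transpose * A * (star U.1).transpose) p.1 p.2 := by
  funext p
  simp only [Matrix.mulVec, dotProduct, conjMatrix, Matrix.kroneckerMap_apply, Matrix.mul_apply,
    Fintype.sum_prod_type, Finset.sum_mul, Matrix.transpose_apply]
  rw [Finset.sum_comm]
  refine Finset.sum_congr rfl fun i _ => Finset.sum_congr rfl fun j _ => by ring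

theorem transpose_mul_transpose_star (U : UN N) : U.1.transpose * (star U.1).transpose = 1 := by
  rw [← Matrix.transpose_mul, Matrix.mem_unitaryGroup_iff'.1 U.2, Matrix.transpose_one]

theorem transpose_star_mul_transpose (U : UN N) : (star U.1).transpose * U.1.transpose = 1 := by
  rw [← Matrix.transpose_mul, Matrix.mem_unitaryGroup_iff.1 U.2, Matrix.transpose_one]

/-- A polynomial function on matrices is invariant under unitary conjugation. -/
def IsConjInvariant (f : MvPolynomial (Fin N × Fin N) ℂ) : Prop :=
  ∀ U : UN N, linearSubst (conjMatrix U) f = f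

theorem isConjInvariant_iff {f : MvPolynomial (Fin N × Fin N) ℂ} :
    IsConjInvariant f ↔ ∀ (U : UN N) (A : Matrix (Fin N) (Fin N) ℂ),
      MvPolynomial.eval (fun p => (U.1.transpose * A * (star U.1).transpose) p.1 p.2) f
        = MvPolynomial.eval (fun p => A p.1 p.2) f := by
  constructor
  · intro h U A
    rw [← conjMatrix_mulVec, ← eval_linearSubst, h U]
  · intro h U
    refine MvPolynomial.funext fun x => ?_
    rw [eval_linearSubst]
    have := h U (Matrix.of fun i j => x (i, j))
    rw [← conjMatrix_mulVec] at this
    simpa using this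

/-- Restriction of a polynomial function on matrices to the diagonal matrices. -/
def restrictDiagonal : MvPolynomial (Fin N × Fin N) ℂ →ₐ[ℂ] MvPolynomial (Fin N) ℂ :=
  MvPolynomial.aeval fun p => if p.1 = p.2 then MvPolynomial.X p.1 else 0

theorem eval_restrictDiagonal (f : MvPolynomial (Fin N × Fin N) ℂ) (y : Fin N → ℂ) :
    MvPolynomial.eval y (restrictDiagonal f)
      = MvPolynomial.eval (fun p => Matrix.diagonal y p.1 p.2) f := by
  have h : (MvPolynomial.aeval y).comp restrictDiagonal
      = MvPolynomial.aeval (R := ℂ) (fun p : Fin N × Fin N => Matrix.diagonal y p.1 p.2) := by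
    refine MvPolynomial.algHom_ext fun p => ?_
    simp only [restrictDiagonal, AlgHom.comp_apply, MvPolynomial.aeval_X, Matrix.diagonal_apply]
    split_ifs <;> simp
  exact DFunLike.congr_fun h f

/-- The substitution whose values at real points are the Hermitian matrices. -/
def hermitianSubst (N : ℕ) : Matrix (Fin N × Fin N) (Fin N × Fin N) ℂ :=
  Matrix.of fun p r => (1 + Complex.I) * (if r = p then 1 else 0)
    + (1 - Complex.I) * (if r = p.swap then 1 else 0)

theorem hermitianSubst_mulVec (x : Fin N × Fin N → ℂ) (p : Fin N × Fin N) :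
    (hermitianSubst N).mulVec x p = (1 + Complex.I) * x p + (1 - Complex.I) * x p.swap := by
  simp [hermitianSubst, Matrix.mulVec, dotProduct, add_mul, Finset.sum_add_distrib]

theorem exists_hermitianSubst_mul_eq_one (N : ℕ) : ∃ T, hermitianSubst N * T = 1 := by
  refine IsUnit.exists_right_inv ?_
  rw [← Matrix.mulVec_injective_iff_isUnit]
  intro x y h
  funext p
  have h1 := congrFun h p
  have h2 := congrFun h p.swap
  rw [hermitianSubst_mulVec, hermitianSubst_mulVec] at h1 h2
  rw [Prod.swap_swap] at h2
  have h3 : (4 * Complex.I) * x p = (4 * Complex.I) * y p := by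
    linear_combination (1 + Complex.I) * h1 - (1 - Complex.I) * h2
  exact mul_left_cancel₀ (by simp) h3

/-- A conjugation-invariant polynomial function vanishing on the diagonal matrices is zero. -/
theorem IsConjInvariant.eq_zero_of_restrictDiagonal {f : MvPolynomial (Fin N × Fin N) ℂ}
    (hf : IsConjInvariant f) (h0 : restrictDiagonal f = 0) : f = 0 := by
  obtain ⟨T, hT⟩ := exists_hermitianSubst_mul_eq_one N
  -- The substitution is invertible, so it suffices that $f$ vanish after it. A polynomial vanishing
  -- at all real points is zero, and at real points the substituted matrix is Hermitian, hence
  -- unitarily conjugate to a diagonal matrix, where $f$ vanishes by `h0`.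
  suffices h : linearSubst (hermitianSubst N) f = 0 by
    have := linearSubst_linearSubst T (hermitianSubst N) f
    rw [h, hT, linearSubst_one, map_zero] at this
    exact this.symm
  refine MvPolynomial.funext_set (fun _ => Set.range ((↑) : ℝ → ℂ))
    (fun _ => Set.infinite_range_of_injective Complex.ofReal_injective) fun x hx => ?_
  rw [map_zero, eval_linearSubst]
  let A : Matrix (Fin N) (Fin N) ℂ := Matrix.of fun i j => (hermitianSubst N).mulVec x (i, j)
  have hreal : ∀ p, starRingEnd ℂ (x p) = x p := by
    intro p
    obtain ⟨r, hr⟩ := hx p (Set.mem_univ p)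
    have hr' : (r : ℂ) = x p := hr
    rw [← hr', Complex.conj_ofReal]
  have hA : A.IsHermitian := by
    ext i j
    simp only [A, Matrix.conjTranspose_apply, Matrix.of_apply, hermitianSubst_mulVec,
      Prod.swap_prod_mk, ← starRingEnd_apply, map_add, map_mul, map_sub, map_one, Complex.conj_I,
      hreal]
    ring
  have hs := hA.spectral_theorem
  rw [Unitary.conjStarAlgAut_apply] at hs
  set V := hA.eigenvectorUnitary
  -- The action is $X\mapsto U^{\mathsf T}X\bar U$, so the eigenvector matrix has to enter
  -- transposed.
  have hV : V.1.transpose ∈ Matrix.unitaryGroup (Fin N) ℂ := by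
    rw [Matrix.mem_unitaryGroup_iff]
    have : star V.1.transpose = (star V.1).transpose := by
      ext i j; simp [Matrix.star_apply]
    rw [this]
    exact transpose_mul_transpose_star V
  have h2 := isConjInvariant_iff.1 hf ⟨V.1.transpose, hV⟩
    (Matrix.diagonal (RCLike.ofReal ∘ hA.eigenvalues))
  rw [← eval_restrictDiagonal, h0, map_zero] at h2
  rw [← h2]
  congr 2
  funext p
  have h3 : (star V.1.transpose).transpose = star V.1 := by
    ext i j; simp [Matrix.star_apply]
  simp only [Matrix.transpose_transpose, h3]
  exact congrFun (congrFun hs p.1) p.2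

/-- Conjugation by a permutation matrix permutes the entries of a diagonal matrix. -/
theorem IsConjInvariant.isSymmetric_restrictDiagonal {f : MvPolynomial (Fin N × Fin N) ℂ}
    (hf : IsConjInvariant f) : (restrictDiagonal f).IsSymmetric := by
  intro e
  refine MvPolynomial.funext fun y => ?_
  rw [MvPolynomial.eval_rename, eval_restrictDiagonal, eval_restrictDiagonal]
  let P : Matrix (Fin N) (Fin N) ℂ := Matrix.of fun i j => if i = e j then 1 else 0
  have hP : P ∈ Matrix.unitaryGroup (Fin N) ℂ := by
    rw [Matrix.mem_unitaryGroup_iff']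
    ext i j
    rcases eq_or_ne i j with h | h
    · subst h
      simp [P, Matrix.mul_apply, Matrix.star_apply, apply_ite]
    · simp [P, Matrix.mul_apply, Matrix.star_apply, h, h.symm, apply_ite]
  rw [← isConjInvariant_iff.1 hf ⟨P, hP⟩ (Matrix.diagonal y)]
  congr 2
  funext p
  rcases eq_or_ne p.1 p.2 with h | h
  · simp [P, Matrix.mul_apply, Matrix.star_apply, h, apply_ite]
  · simp [P, Matrix.mul_apply, Matrix.star_apply, Matrix.diagonal_apply, h, h.symm, apply_ite]

/-- The coefficients of the characteristic polynomial, normalized to restrict to the elementary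
symmetric polynomials. -/
def charpolyInvariant (N : ℕ) (k : Fin N) : MvPolynomial (Fin N × Fin N) ℂ :=
  MvPolynomial.C ((-1) ^ ((k : ℕ) + 1)) * (Matrix.charpoly.univ ℂ (Fin N)).coeff (N - (k + 1))

theorem isHomogeneous_charpolyInvariant (k : Fin N) :
    (charpolyInvariant N k).IsHomogeneous ((k : ℕ) + 1) := by
  rw [← zero_add ((k : ℕ) + 1)]
  refine (MvPolynomial.isHomogeneous_C _ _).mul ?_
  refine Matrix.charpoly.univ_coeff_isHomogeneous ℂ (Fin N) _ _ ?_
  rw [Fintype.card_fin]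
  have := k.2
  omega

theorem eval_charpolyInvariant (A : Matrix (Fin N) (Fin N) ℂ) (k : Fin N) :
    MvPolynomial.eval (fun p => A p.1 p.2) (charpolyInvariant N k)
      = (-1) ^ ((k : ℕ) + 1) * A.charpoly.coeff (N - (k + 1)) := by
  rw [charpolyInvariant, map_mul, MvPolynomial.eval_C]
  congr 1
  exact Matrix.charpoly.univ_coeff_eval₂Hom (Fin N) (RingHom.id ℂ) (fun p => A p.1 p.2) _

theorem isConjInvariant_charpolyInvariant (k : Fin N) :
    IsConjInvariant (charpolyInvariant N k) := by
  rw [isConjInvariant_iff]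
  intro U A
  rw [eval_charpolyInvariant, eval_charpolyInvariant, Matrix.charpoly_mul_comm, ← mul_assoc,
    transpose_star_mul_transpose, one_mul]

theorem restrictDiagonal_charpolyInvariant (k : Fin N) :
    restrictDiagonal (charpolyInvariant N k) = MvPolynomial.esymm (Fin N) ℂ (k + 1) := by
  refine MvPolynomial.funext fun y => ?_
  rw [eval_restrictDiagonal, eval_charpolyInvariant, Matrix.charpoly_diagonal]
  have h := Multiset.prod_X_sub_C_coeff (Finset.univ.val.map y) (k := N - (k + 1)) (by simp)
  rw [Multiset.map_map] at h
  have h2 : ∏ i, (Polynomial.X - Polynomial.C (y i))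
      = (Multiset.map ((fun t => Polynomial.X - Polynomial.C t) ∘ y) Finset.univ.val).prod := rfl
  have h3 : N - (N - ((k : ℕ) + 1)) = k + 1 := by have := k.2; omega
  rw [h2, h, Multiset.card_map, Finset.card_val, Finset.card_univ, Fintype.card_fin, h3,
    ← mul_assoc, ← mul_pow]
  have h4 := MvPolynomial.aeval_esymm_eq_multiset_esymm (Fin N) ℂ (k + 1) y
  rw [← h4, neg_mul_neg, one_mul, one_pow, one_mul, ← MvPolynomial.coe_aeval_eq_eval]
  rfl

/-- Polynomials in the characteristic coefficients. -/
abbrev invariantHom (N : ℕ) : MvPolynomial (Fin N) ℂ →ₐ[ℂ] MvPolynomial (Fin N × Fin N) ℂ :=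
  MvPolynomial.aeval (charpolyInvariant N)

theorem isConjInvariant_invariantHom (b : MvPolynomial (Fin N) ℂ) :
    IsConjInvariant (invariantHom N b) := by
  intro U
  have h : (linearSubst (conjMatrix U)).comp (invariantHom N) = invariantHom N := by
    refine MvPolynomial.algHom_ext fun k => ?_
    simpa using isConjInvariant_charpolyInvariant k U
  exact DFunLike.congr_fun h b

theorem restrictDiagonal_invariantHom (b : MvPolynomial (Fin N) ℂ) :
    restrictDiagonal (invariantHom N b)
      = (MvPolynomial.esymmAlgHom (Fin N) ℂ N b : MvPolynomial (Fin N) ℂ) := by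
  rw [MvPolynomial.esymmAlgHom_apply]
  have h : restrictDiagonal.comp (invariantHom N)
      = MvPolynomial.aeval fun i : Fin N => MvPolynomial.esymm (Fin N) ℂ (i + 1) := by
    refine MvPolynomial.algHom_ext fun k => ?_
    simpa using restrictDiagonal_charpolyInvariant k
  exact DFunLike.congr_fun h b

/-- On diagonal matrices the generators become the elementary symmetric polynomials, which are
algebraically independent. -/
theorem invariantHom_injective (N : ℕ) : Function.Injective (invariantHom N) := by
  intro b c h
  refine (MvPolynomial.esymmAlgHom_fin_bijective ℂ N).1 (Subtype.ext ?_)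
  rw [← restrictDiagonal_invariantHom, h, restrictDiagonal_invariantHom]

/-- The weights of the elementary symmetric polynomials. -/
abbrev esymmWeight (N : ℕ) : Fin N → ℕ := fun k => (k : ℕ) + 1

/-- The restriction of $f$ to diagonal matrices is symmetric, hence a polynomial $b$ in the
elementary symmetric polynomials. Then $f$ and `invariantHom N b` are invariants that agree on the
diagonal, so they coincide; the weight $n$ component of $b$ already gives $f$. -/
theorem exists_invariantHom_eq {f : MvPolynomial (Fin N × Fin N) ℂ} {n : ℕ}
    (hf : IsConjInvariant f) (hn : f.IsHomogeneous n) :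
    ∃ b, b.IsWeightedHomogeneous (esymmWeight N) n ∧ invariantHom N b = f := by
  obtain ⟨b, hb⟩ := (MvPolynomial.esymmAlgHom_fin_bijective ℂ N).2
    ⟨restrictDiagonal f, hf.isSymmetric_restrictDiagonal⟩
  have hb' : restrictDiagonal (invariantHom N b) = restrictDiagonal f := by
    rw [restrictDiagonal_invariantHom, hb]
  have hbf : invariantHom N b = f := by
    rw [← sub_eq_zero]
    refine IsConjInvariant.eq_zero_of_restrictDiagonal (fun U => ?_) (by rw [map_sub, hb', sub_self])
    rw [map_sub, isConjInvariant_invariantHom b U, hf U]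
  refine ⟨MvPolynomial.weightedHomogeneousComponent (esymmWeight N) n b,
    MvPolynomial.weightedHomogeneousComponent_isWeightedHomogeneous _ _, ?_⟩
  rw [← homogeneousComponent_aeval _ _ isHomogeneous_charpolyInvariant, hbf,
    MvPolynomial.homogeneousComponent_eq_self hn]

/-- The coefficient vectors of the invariant forms of degree `n`. -/
def invariantForms (N n : ℕ) : Submodule ℂ (MonomialIdx (Fin N × Fin N) n → ℂ) where
  carrier := {v | ∀ U : UN N, (symPow n (conjMatrix U)).mulVec v = v}
  zero_mem' U := Matrix.mulVec_zero _
  add_mem' hv hw U := by rw [Matrix.mulVec_add, hv U, hw U]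
  smul_mem' c v hv U := by rw [Matrix.mulVec_smul, hv U]

theorem mem_invariantForms_iff {n : ℕ} (v : MonomialIdx (Fin N × Fin N) n → ℂ) :
    v ∈ invariantForms N n ↔ IsConjInvariant (formOfCoeffs n v) := by
  refine forall_congr' fun U => ?_
  rw [linearSubst_formOfCoeffs, (formOfCoeffs_injective n).eq_iff]

/-- The invariants are a polynomial ring on generators of degrees $1,\dots,N$, so the monomials of
weight $n$ in the generators give a basis in degree $n$. -/
theorem finrank_invariantForms (N n : ℕ) :
    Module.finrank ℂ (invariantForms N n)
      = Nat.card {a : Fin N →₀ ℕ // Finsupp.weight (esymmWeight N) a = n} := by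
  let L : MvPolynomial.weightedHomogeneousSubmodule ℂ (esymmWeight N) n →ₗ[ℂ]
      (MonomialIdx (Fin N × Fin N) n → ℂ) :=
    LinearMap.pi fun m => (MvPolynomial.lcoeff ℂ m.1) ∘ₗ (invariantHom N).toLinearMap ∘ₗ
      Submodule.subtype _
  have hL : ∀ b, formOfCoeffs n (L b) = invariantHom N b.1 := fun b =>
    formOfCoeffs_coeff (isHomogeneous_aeval_of_isWeightedHomogeneous _ _
      isHomogeneous_charpolyInvariant b.2)
  have hinj : Function.Injective L := by
    intro b c h
    refine Subtype.ext (invariantHom_injective N ?_)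
    rw [← hL, h, hL]
  have hrange : LinearMap.range L = invariantForms N n := by
    ext v
    rw [mem_invariantForms_iff, LinearMap.mem_range]
    constructor
    · rintro ⟨b, rfl⟩
      rw [hL]
      exact isConjInvariant_invariantHom _
    · intro h
      obtain ⟨b, hb, hbv⟩ := exists_invariantHom_eq h (isHomogeneous_formOfCoeffs v)
      exact ⟨⟨b, hb⟩, formOfCoeffs_injective n (by rw [hL, hbv])⟩
  rw [← hrange, LinearMap.finrank_range_of_inj hinj,
    MvPolynomial.weightedHomogeneousSubmodule_eq_finsupp_supported]
  exact Module.finrank_eq_nat_card_basis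
    (MvPolynomial.basisRestrictSupport ℂ {d | Finsupp.weight (esymmWeight N) d = n})

end Conjugation

/-! ### Generating series -/

section Series

/-- Nonnegative terms may be grouped and ungrouped freely. Used to sort partitions by size and to
regroup exponent vectors by degree or by weight. -/
theorem hasSum_iff_hasSum_fiber {α : Type*} (f : α → ℕ) (F : ℕ → Finset α)
    (hF : ∀ n x, x ∈ F n ↔ f x = n) {g : α → ℝ} (hg : ∀ x, 0 ≤ g x) {S : ℝ} :
    HasSum g S ↔ HasSum (fun n => ∑ x ∈ F n, g x) S := by
  have hfin : ∀ n, Fintype {x // f x = n} := fun n =>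
    Fintype.subtype (F n) (hF n)
  have hfib : ∀ n, HasSum (fun x : {x // f x = n} => g x.1) (∑ x ∈ F n, g x) := by
    intro n
    rw [Finset.sum_subtype (F n) (hF n)]
    exact hasSum_fintype _
  have key : ∀ {T : ℝ}, HasSum g T → HasSum (fun n => ∑ x ∈ F n, g x) T := fun h =>
    ((Equiv.sigmaFiberEquiv f).hasSum_iff.2 h).sigma hfib
  refine ⟨key, fun h => ?_⟩
  have hs : Summable (g ∘ Equiv.sigmaFiberEquiv f) := by
    refine (summable_sigma_of_nonneg (f := g ∘ Equiv.sigmaFiberEquiv f) fun _ => hg _).2 ?_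
    refine ⟨fun n => (hfib n).summable, ?_⟩
    convert h.summable using 2 with n
    exact (hfib n).tsum_eq
  obtain ⟨T, hT⟩ := (Equiv.sigmaFiberEquiv f).summable_iff.1 hs
  rwa [h.unique (key hT)]

/-- Absolute summability is carried along the induction because the Cauchy product of two series
needs it. -/
theorem hasSum_coeff_prod_geomSeries {ι : Type*} (r : ι → ℂ) (hr : ∀ i, ‖r i‖ < 1)
    (s : Finset ι) :
    Summable (fun n => ‖PowerSeries.coeff n (∏ i ∈ s, geomSeries (r i))‖) ∧
      HasSum (fun n => PowerSeries.coeff n (∏ i ∈ s, geomSeries (r i))) (∏ i ∈ s, (1 - r i)⁻¹) := by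
  classical
  induction s using Finset.induction_on with
  | empty =>
    have h : ∀ n, n ≠ 0 → PowerSeries.coeff n (1 : PowerSeries ℂ) = 0 := fun n hn => by
      simp [PowerSeries.coeff_one, hn]
    constructor
    · refine summable_of_ne_finset_zero (s := {0}) fun n hn => ?_
      rw [Finset.prod_empty, h n (by simpa using hn), norm_zero]
    · simpa using hasSum_single 0 h
  | insert i s hi ih =>
    have h1 : Summable (fun n => ‖PowerSeries.coeff n (geomSeries (r i))‖) := by
      simpa [geomSeries] using summable_geometric_of_lt_one (norm_nonneg _) (hr i)
    have h2 : HasSum (fun n => PowerSeries.coeff n (geomSeries (r i))) (1 - r i)⁻¹ := by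
      simpa [geomSeries] using hasSum_geometric_of_norm_lt_one (hr i)
    rw [Finset.prod_insert hi, Finset.prod_insert hi]
    simp only [PowerSeries.coeff_mul]
    have h3 := summable_norm_sum_mul_antidiagonal_of_summable_norm h1 ih.1
    refine ⟨h3, ?_⟩
    rw [← h2.tsum_eq, ← ih.2.tsum_eq,
      tsum_mul_tsum_eq_tsum_sum_antidiagonal_of_summable_norm h1 ih.1]
    exact h3.of_norm.hasSum

theorem hasSum_complete_homogeneous {ι : Type*} [Fintype ι] [DecidableEq ι] (a : ι → ℂ) (q : ℂ)
    (h : ∀ i, ‖q * a i‖ < 1) :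
    HasSum (fun n : ℕ => q ^ n *
      ∑ m ∈ Finset.finsuppAntidiag (Finset.univ : Finset ι) n, ∏ i, a i ^ m i)
      (∏ i, (1 - q * a i)⁻¹) := by
  convert (hasSum_coeff_prod_geomSeries (fun i => q * a i) h Finset.univ).2 using 2 with n
  rw [coeff_prod_geomSeries, Finset.mul_sum]
  refine Finset.sum_congr rfl fun m hm => ?_
  simp only [mul_pow, Finset.prod_mul_distrib]
  rw [Finset.prod_pow_eq_pow_sum, ← (Finset.mem_finsuppAntidiag.1 hm).1]

/-- Weighted compositions are counted by a product of geometric series. -/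
theorem hasSum_card_weight_mul_pow (N : ℕ) {q : ℝ} (hq0 : 0 ≤ q) (hq1 : q < 1) :
    HasSum (fun n : ℕ =>
        q ^ n * (Nat.card {a : Fin N →₀ ℕ // Finsupp.weight (esymmWeight N) a = n} : ℝ))
      (∏ k : Fin N, (1 - q ^ ((k : ℕ) + 1))⁻¹) := by
  -- One family summed in two groupings: by total degree it gives the product of geometric series,
  -- by weight it gives the count.
  let g : (Fin N →₀ ℕ) → ℝ := fun a => ∏ k : Fin N, (q ^ ((k : ℕ) + 1)) ^ a k
  have hg : ∀ a, 0 ≤ g a := fun a => by positivity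
  have h1 : HasSum g (∏ k : Fin N, (1 - q ^ ((k : ℕ) + 1))⁻¹) := by
    rw [hasSum_iff_hasSum_fiber (fun a : Fin N →₀ ℕ => ∑ k, a k)
      (fun n => Finset.finsuppAntidiag Finset.univ n) (fun n a => by simp) hg, ← Complex.hasSum_ofReal]
    have h := hasSum_complete_homogeneous (fun k : Fin N => ((q : ℂ) ^ ((k : ℕ) + 1))) 1 (fun k => by
      rw [one_mul, norm_pow, Complex.norm_real, Real.norm_of_nonneg hq0]
      exact pow_lt_one₀ hq0 hq1 (Nat.succ_ne_zero _))
    simpa [g] using h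
  have hfin : ∀ n, {a : Fin N →₀ ℕ | Finsupp.weight (esymmWeight N) a = n}.Finite := fun n =>
    Finsupp.finite_of_nat_weight_eq (esymmWeight N) (fun k => Nat.succ_ne_zero _) n
  rw [hasSum_iff_hasSum_fiber (fun a : Fin N →₀ ℕ => Finsupp.weight (esymmWeight N) a)
    (fun n => (hfin n).toFinset) (fun n a => by simp) hg] at h1
  convert h1 using 2 with n
  have h2 : ∀ a ∈ (hfin n).toFinset, g a = q ^ n := by
    intro a ha
    rw [Set.Finite.mem_toFinset] at ha
    have ha' : Finsupp.weight (esymmWeight N) a = n := ha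
    rw [Finsupp.weight_apply, Finsupp.sum_fintype _ _ (by simp)] at ha'
    rw [← ha', ← Finset.prod_pow_eq_pow_sum]
    refine Finset.prod_congr rfl fun k _ => ?_
    rw [smul_eq_mul, mul_comm, pow_mul]
  rw [Finset.sum_congr rfl h2, Finset.sum_const, nsmul_eq_mul, mul_comm,
    ← Nat.card_eq_card_finite_toFinset]
  rfl

end Series

/-! ### The partition function, its mean and its logarithm -/

section Partition

open scoped Kronecker

variable {N : ℕ}

theorem conjMatrix_eq {u : Fin N → ℂ} {V W : Matrix (Fin N) (Fin N) ℂ} {U : UN N}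
    (hU : U.1 = V * Matrix.diagonal u * W)
    (hU' : star U.1 = V * Matrix.diagonal (fun i => starRingEnd ℂ (u i)) * W) :
    conjMatrix U = (W.transpose ⊗ₖ V) *
      Matrix.diagonal (fun p : Fin N × Fin N => u p.1 * starRingEnd ℂ (u p.2)) *
      (V.transpose ⊗ₖ W) := by
  rw [← Matrix.diagonal_kronecker_diagonal u (fun i => starRingEnd ℂ (u i)),
    ← Matrix.mul_kronecker_mul, ← Matrix.mul_kronecker_mul,
    conjMatrix, hU', hU]
  simp only [Matrix.transpose_mul, Matrix.diagonal_transpose, mul_assoc]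

theorem sum_norm_sq_schur {u : Fin N → ℂ} {V W : Matrix (Fin N) (Fin N) ℂ} {U : UN N}
    (hWV : W * V = 1) (hU : U.1 = V * Matrix.diagonal u * W) (n : ℕ) :
    ((∑ lam ∈ YN.ofSize N n, ‖schur lam U‖ ^ 2 : ℝ) : ℂ)
      = cauchyCoeff u (fun i => starRingEnd ℂ (u i)) n := by
  rw [← sum_norm_sq_eval_schurPoly]
  have h : Finset.univ.val.map u = U.1.charpoly.roots := by
    rw [hU, roots_charpoly_conj_diagonal hWV]
  congr 1
  exact Finset.sum_congr rfl fun lam _ => by rw [schur_eq lam U u h]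

/-- Both sides are the complete homogeneous polynomial of degree $n$ in the $N^2$ numbers $u_i\bar
u_j$, which are the eigenvalues of `conjMatrix U`. -/
theorem sum_norm_sq_schur_eq_trace (U : UN N) (n : ℕ) :
    ((∑ lam ∈ YN.ofSize N n, ‖schur lam U‖ ^ 2 : ℝ) : ℂ) = (symPow n (conjMatrix U)).trace := by
  obtain ⟨u, V, W, hVW, hWV, -, hU, hU'⟩ := exists_diagonalization U
  rw [sum_norm_sq_schur hWV hU, conjMatrix_eq hU hU', trace_symPow_conj_diagonal]
  · rfl
  · rw [← Matrix.mul_kronecker_mul, ← Matrix.transpose_mul, hWV, Matrix.transpose_one,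
      Matrix.one_kronecker_one]

theorem continuous_coeff_linearSubst {σ : Type*} [Fintype σ] (p : MvPolynomial σ ℂ) :
    ∀ m : σ →₀ ℕ, Continuous fun S : Matrix σ σ ℂ => MvPolynomial.coeff m (linearSubst S p) := by
  classical
  induction p using MvPolynomial.induction_on with
  | C c =>
    intro m
    have : ∀ S : Matrix σ σ ℂ, linearSubst S (MvPolynomial.C c) = MvPolynomial.C c := fun S =>
      (linearSubst S).commutes c
    simp only [this]
    exact continuous_const
  | add p q hp hq =>
    intro m
    simp only [map_add, MvPolynomial.coeff_add]
    exact (hp m).add (hq m)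
  | mul_X p s hp =>
    intro m
    simp only [map_mul, linearSubst_X, Finset.mul_sum, MvPolynomial.coeff_sum]
    refine continuous_finsetSum _ fun t _ => ?_
    simp only [mul_left_comm _ (MvPolynomial.C _) _, MvPolynomial.coeff_C_mul,
      MvPolynomial.coeff_mul_X']
    refine Continuous.mul (by fun_prop) ?_
    split_ifs
    · exact hp _
    · exact continuous_const

theorem continuous_conjMatrix : Continuous (conjMatrix : UN N → _) := by
  refine continuous_matrix fun p r => ?_
  have h : ∀ i j, Continuous fun U : UN N => U.1 i j := fun i j =>
    continuous_subtype_val.matrix_elem i j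
  simp only [conjMatrix, Matrix.kroneckerMap_apply, Matrix.transpose_apply, Matrix.star_apply]
  exact (h _ _).mul (h _ _).star

theorem continuous_symPow_conjMatrix (n : ℕ) :
    Continuous fun U : UN N => symPow n (conjMatrix U) :=
  continuous_matrix fun _ _ => (continuous_coeff_linearSubst _ _).comp continuous_conjMatrix

instance : (cue N).IsMulLeftInvariant := by
  unfold cue
  infer_instance

/-- The list of eigenvalues is an arbitrary choice at each $U$, so continuity is read off from the
trace formula instead. -/
theorem continuous_sum_norm_sq_schur (N n : ℕ) :
    Continuous fun U : UN N => ∑ lam ∈ YN.ofSize N n, ‖schur lam U‖ ^ 2 := by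
  have h : (fun U : UN N => ∑ lam ∈ YN.ofSize N n, ‖schur lam U‖ ^ 2)
      = fun U => (symPow n (conjMatrix U)).trace.re := by
    funext U
    rw [← sum_norm_sq_schur_eq_trace, Complex.ofReal_re]
  rw [h]
  exact Complex.continuous_re.comp (continuous_symPow_conjMatrix n).matrix_trace

theorem integrable_of_continuous {E : Type*} [NormedAddCommGroup E] {f : UN N → E}
    (hf : Continuous f) : Integrable f (cue N) :=
  hf.integrable_of_hasCompactSupport (HasCompactSupport.of_compactSpace _)

theorem integral_sum_norm_sq_schur (N n : ℕ) :
    ∫ U, ∑ lam ∈ YN.ofSize N n, ‖schur lam U‖ ^ 2 ∂(cue N)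
      = Nat.card {a : Fin N →₀ ℕ // Finsupp.weight (esymmWeight N) a = n} := by
  rw [← finrank_invariantForms]
  have h := integral_trace_eq_finrank_invariants (cue N)
    (fun U : UN N => symPow n (conjMatrix U)) (continuous_symPow_conjMatrix n)
    (fun U V => by rw [conjMatrix_mul, symPow_mul]) (invariantForms N n) (fun v => Iff.rfl)
  simp only [← sum_norm_sq_schur_eq_trace] at h
  rw [integral_complex_ofReal] at h
  exact_mod_cast h

/-- The logarithm of the partition function, through power sums. -/
def logPartition (q : ℝ) (U : UN N) : ℝ :=
  ∑' k : ℕ, q ^ (k + 1) / ((k + 1 : ℕ) : ℝ) * ‖(U.1 ^ (k + 1)).trace‖ ^ 2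

theorem norm_trace_pow_le (U : UN N) (k : ℕ) : ‖(U.1 ^ k).trace‖ ≤ N := by
  obtain ⟨u, V, W, hVW, hWV, hu, hU, -⟩ := exists_diagonalization U
  rw [hU, conj_diagonal_pow hVW hWV, trace_conj_diagonal hWV]
  refine (norm_sum_le _ _).trans ?_
  simp [norm_pow, hu]

theorem continuous_trace_pow (k : ℕ) : Continuous fun U : UN N => (U.1 ^ k).trace :=
  (continuous_subtype_val.pow k).matrix_trace

variable {q : ℝ}

theorem summable_logPartition_bound (hq0 : 0 ≤ q) (hq1 : q < 1) (C : ℝ) :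
    Summable fun k : ℕ => q ^ (k + 1) / ((k + 1 : ℕ) : ℝ) * C := by
  refine Summable.mul_right _ ?_
  refine Summable.of_nonneg_of_le (fun k => by positivity) (fun k => ?_)
    ((summable_nat_add_iff 1).2 (summable_geometric_of_lt_one hq0 hq1))
  exact div_le_self (by positivity) (by norm_cast; omega)

theorem norm_logPartition_term_le (hq0 : 0 ≤ q) (U : UN N) (k : ℕ) :
    ‖q ^ (k + 1) / ((k + 1 : ℕ) : ℝ) * ‖(U.1 ^ (k + 1)).trace‖ ^ 2‖
      ≤ q ^ (k + 1) / ((k + 1 : ℕ) : ℝ) * (N : ℝ) ^ 2 := by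
  rw [Real.norm_of_nonneg (by positivity)]
  gcongr
  exact norm_trace_pow_le U _

theorem hasSum_logPartition (hq0 : 0 ≤ q) (hq1 : q < 1) (U : UN N) :
    HasSum (fun k : ℕ => q ^ (k + 1) / ((k + 1 : ℕ) : ℝ) * ‖(U.1 ^ (k + 1)).trace‖ ^ 2)
      (logPartition q U) :=
  ((summable_logPartition_bound hq0 hq1 ((N : ℝ) ^ 2)).of_norm_bounded
    (norm_logPartition_term_le hq0 U)).hasSum

theorem continuous_logPartition (hq0 : 0 ≤ q) (hq1 : q < 1) :
    Continuous (logPartition q : UN N → ℝ) :=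
  continuous_tsum (fun k => continuous_const.mul ((continuous_trace_pow (k + 1)).norm.pow 2))
    (summable_logPartition_bound hq0 hq1 ((N : ℝ) ^ 2)) fun k U => norm_logPartition_term_le hq0 U k

theorem norm_sq_sum_eq (v : Fin N → ℂ) :
    ((‖∑ i, v i‖ ^ 2 : ℝ) : ℂ) = ∑ p : Fin N × Fin N, v p.1 * starRingEnd ℂ (v p.2) := by
  rw [Fintype.sum_prod_type' fun i j => v i * starRingEnd ℂ (v j), ← Finset.sum_mul_sum, ← map_sum, Complex.mul_conj,
    Complex.normSq_eq_norm_sq]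

/-- Since $|\sum_i u_i^k|^2=\sum_{i,j}(u_i\bar u_j)^k$, summing over $k$ produces the Taylor series
of $-\log(1-q\,u_i\bar u_j)$ for each pair. -/
theorem exp_logPartition (hq0 : 0 ≤ q) (hq1 : q < 1) {u : Fin N → ℂ}
    {V W : Matrix (Fin N) (Fin N) ℂ} {U : UN N} (hVW : V * W = 1) (hWV : W * V = 1)
    (hu : ∀ i, ‖u i‖ = 1) (hU : U.1 = V * Matrix.diagonal u * W) :
    ((Real.exp (logPartition q U) : ℝ) : ℂ)
      = ∏ p : Fin N × Fin N, (1 - q * (u p.1 * starRingEnd ℂ (u p.2)))⁻¹ := by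
  have hlt : ∀ p : Fin N × Fin N, ‖(q : ℂ) * (u p.1 * starRingEnd ℂ (u p.2))‖ < 1 := by
    intro p
    rw [norm_mul, norm_mul, RCLike.norm_conj, hu, hu, Complex.norm_real, Real.norm_of_nonneg hq0]
    simpa using hq1
  have h1 : HasSum (fun k : ℕ => ∑ p : Fin N × Fin N,
      ((q : ℂ) * (u p.1 * starRingEnd ℂ (u p.2))) ^ (k + 1) / ((k + 1 : ℕ) : ℂ))
      (∑ p : Fin N × Fin N, -Complex.log (1 - q * (u p.1 * starRingEnd ℂ (u p.2)))) := by
    refine hasSum_sum fun p _ => ?_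
    have h := (hasSum_nat_add_iff' 1).2 (Complex.hasSum_taylorSeries_neg_log (hlt p))
    simpa using h
  have h2 := Complex.hasSum_ofReal.2 (hasSum_logPartition hq0 hq1 U)
  have h3 : ((logPartition q U : ℝ) : ℂ)
      = ∑ p : Fin N × Fin N, -Complex.log (1 - q * (u p.1 * starRingEnd ℂ (u p.2))) := by
    refine h2.unique ?_
    convert h1 using 2 with k
    rw [hU, conj_diagonal_pow hVW hWV, trace_conj_diagonal hWV, Complex.ofReal_mul, norm_sq_sum_eq,
      Finset.mul_sum]
    refine Finset.sum_congr rfl fun p _ => ?_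
    push_cast
    simp only [mul_pow, map_pow]
    ring
  rw [Complex.ofReal_exp, h3, Complex.exp_sum]
  refine Finset.prod_congr rfl fun p _ => ?_
  rw [Complex.exp_neg, Complex.exp_log]
  intro h0
  have := hlt p
  rw [← sub_eq_zero.1 h0] at this
  simp at this

theorem hasSum_pow_mul_sum_norm_sq_schur (hq0 : 0 ≤ q) (hq1 : q < 1) (U : UN N) :
    HasSum (fun n : ℕ => q ^ n * ∑ lam ∈ YN.ofSize N n, ‖schur lam U‖ ^ 2)
      (Real.exp (logPartition q U)) := by
  obtain ⟨u, V, W, hVW, hWV, hu, hU, -⟩ := exists_diagonalization U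
  rw [← Complex.hasSum_ofReal, exp_logPartition hq0 hq1 hVW hWV hu hU]
  simp only [Complex.ofReal_mul, Complex.ofReal_pow, sum_norm_sq_schur hWV hU]
  refine hasSum_complete_homogeneous (fun p : Fin N × Fin N => u p.1 * starRingEnd ℂ (u p.2)) q
    fun p => ?_
  rw [norm_mul, norm_mul, RCLike.norm_conj, hu, hu, Complex.norm_real, Real.norm_of_nonneg hq0]
  simpa using hq1

theorem hasSum_partitionFunction (hq0 : 0 ≤ q) (hq1 : q < 1) (U : UN N) :
    HasSum (fun lam : YN N => q ^ lam.size * ‖schur lam U‖ ^ 2) (Real.exp (logPartition q U)) := by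
  rw [hasSum_iff_hasSum_fiber YN.size (YN.ofSize N) (fun n lam => YN.mem_ofSize)
    fun lam => by positivity]
  convert hasSum_pow_mul_sum_norm_sq_schur hq0 hq1 U using 2 with n
  rw [Finset.mul_sum]
  exact Finset.sum_congr rfl fun lam hlam => by rw [YN.mem_ofSize.1 hlam]

theorem partitionFunction_eq_exp (hq0 : 0 ≤ q) (hq1 : q < 1) (U : UN N) :
    partitionFunction q U = Real.exp (logPartition q U) :=
  (hasSum_partitionFunction hq0 hq1 U).tsum_eq

/-- The annealed partition function. -/
theorem integral_exp_logPartition (N : ℕ) (hq0 : 0 ≤ q) (hq1 : q < 1) :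
    ∫ U : UN N, Real.exp (logPartition q U) ∂(cue N) = ∏ k : Fin N, (1 - q ^ ((k : ℕ) + 1))⁻¹ := by
  have hcard := hasSum_card_weight_mul_pow N hq0 hq1
  have hint : ∀ n : ℕ, ∫ U, q ^ n * ∑ lam ∈ YN.ofSize N n, ‖schur lam U‖ ^ 2 ∂(cue N)
      = q ^ n * (Nat.card {a : Fin N →₀ ℕ // Finsupp.weight (esymmWeight N) a = n} : ℝ) := by
    intro n
    rw [integral_const_mul, integral_sum_norm_sq_schur]
  have h := hasSum_integral_of_summable_integral_norm (μ := cue N)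
    (F := fun (n : ℕ) U => q ^ n * ∑ lam ∈ YN.ofSize N n, ‖schur lam U‖ ^ 2)
    (fun n => integrable_of_continuous (continuous_const.mul (continuous_sum_norm_sq_schur N n)))
    (by
      have hn : ∀ (n : ℕ) (U : UN N), ‖q ^ n * ∑ lam ∈ YN.ofSize N n, ‖schur lam U‖ ^ 2‖
          = q ^ n * ∑ lam ∈ YN.ofSize N n, ‖schur lam U‖ ^ 2 := fun n U =>
        Real.norm_of_nonneg (by positivity)
      simp only [hn, hint]
      exact hcard.summable)
  simp only [hint, (hasSum_pow_mul_sum_norm_sq_schur hq0 hq1 _).tsum_eq] at h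
  exact h.unique hcard

/-- The quenched free energy. -/
theorem hasSum_integral_logPartition (N : ℕ) (hq0 : 0 ≤ q) (hq1 : q < 1) :
    HasSum (fun k : ℕ => q ^ (k + 1) / ((k + 1 : ℕ) : ℝ) *
        ∫ U : UN N, ‖(U.1 ^ (k + 1)).trace‖ ^ 2 ∂(cue N))
      (∫ U : UN N, logPartition q U ∂(cue N)) := by
  have hcont : ∀ k : ℕ, Continuous fun U : UN N =>
      q ^ (k + 1) / ((k + 1 : ℕ) : ℝ) * ‖(U.1 ^ (k + 1)).trace‖ ^ 2 := fun k =>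
    continuous_const.mul ((continuous_trace_pow (k + 1)).norm.pow 2)
  have h := hasSum_integral_of_summable_integral_norm (μ := cue N)
    (F := fun (k : ℕ) (U : UN N) => q ^ (k + 1) / ((k + 1 : ℕ) : ℝ) * ‖(U.1 ^ (k + 1)).trace‖ ^ 2)
    (fun k => integrable_of_continuous (hcont k))
    (Summable.of_nonneg_of_le (fun k => integral_nonneg fun U => norm_nonneg _) (fun k => by
      have := integral_mono (integrable_of_continuous (hcont k).norm) (integrable_const _)
        fun U => norm_logPartition_term_le hq0 U k
      simpa using this)
      (summable_logPartition_bound hq0 hq1 ((N : ℝ) ^ 2)))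
  simp only [integral_const_mul] at h
  exact h

end Partition

/-! ### Schwinger–Dyson equation for traces of powers -/

section SchwingerDyson

variable {N : ℕ}

/-- The one-parameter subgroup of the unitary group generated by a skew-Hermitian matrix. -/
def expUnitary (X : Matrix (Fin N) (Fin N) ℂ) (hX : star X = -X) (t : ℝ) : UN N :=
  ⟨NormedSpace.exp (t • X), by
    have hs : star (t • X) = -(t • X) := by
      rw [star_smul, hX, smul_neg]
      rfl
    rw [Matrix.mem_unitaryGroup_iff', Matrix.star_eq_conjTranspose, ← Matrix.exp_conjTranspose,
      ← Matrix.star_eq_conjTranspose, hs,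
      ← Matrix.exp_add_of_commute _ _ ((Commute.refl (t • X)).neg_left), neg_add_cancel,
      NormedSpace.exp_zero]⟩

/-- By left invariance $\int F(e^{tX}U)\,dU$ does not depend on $t$. Differentiation under the
integral is dominated by the maximum of $|G|$ on the compact group. -/
theorem integral_derivative_eq_zero {X : Matrix (Fin N) (Fin N) ℂ} (hX : star X = -X)
    {F G : UN N → ℂ} (hF : Continuous F) (hG : Continuous G)
    (h : ∀ U t, HasDerivAt (fun t => F (expUnitary X hX t * U)) (G (expUnitary X hX t * U)) t) :
    ∫ U, G U ∂(cue N) = 0 := by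
  obtain ⟨C, hC⟩ := (isCompact_univ (X := UN N)).exists_bound_of_continuousOn hG.continuousOn
  have hd := (hasDerivAt_integral_of_dominated_loc_of_deriv_le (μ := cue N) (x₀ := (0 : ℝ))
    (F := fun t U => F (expUnitary X hX t * U)) (F' := fun t U => G (expUnitary X hX t * U))
    (bound := fun _ => C) univ_mem
    (Eventually.of_forall fun t => (hF.comp (continuous_const.mul continuous_id)).aestronglyMeasurable)
    (integrable_of_continuous (hF.comp (continuous_const.mul continuous_id)))
    (hG.comp (continuous_const.mul continuous_id)).aestronglyMeasurable
    (Eventually.of_forall fun U t _ => hC _ (Set.mem_univ _)) (integrable_const _)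
    (Eventually.of_forall fun U t _ => h U t)).2
  simp only [integral_mul_left_eq_self] at hd
  exact hd.unique (hasDerivAt_const _ _)

/-- The derivative of `U ↦ U ^ k` along the vector field `U ↦ X U`. -/
def powDeriv (k : ℕ) (X U : Matrix (Fin N) (Fin N) ℂ) : Matrix (Fin N) (Fin N) ℂ :=
  ∑ l ∈ Finset.range k, U ^ (k - 1 - l) * (X * U) * U ^ l

theorem trace_powDeriv (k : ℕ) (X U : Matrix (Fin N) (Fin N) ℂ) :
    (powDeriv k X U).trace = k * (X * U ^ k).trace := by
  rw [powDeriv, Matrix.trace_sum]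
  have h : ∀ l ∈ Finset.range k, (U ^ (k - 1 - l) * (X * U) * U ^ l).trace = (X * U ^ k).trace := by
    intro l hl
    rw [Finset.mem_range] at hl
    rw [Matrix.trace_mul_cycle, ← Matrix.trace_mul_comm, mul_assoc, ← pow_add, ← pow_succ']
    congr 3
    omega
  rw [Finset.sum_congr rfl h]
  simp

theorem powDeriv_add (k : ℕ) (X Y U : Matrix (Fin N) (Fin N) ℂ) :
    powDeriv k (X + Y) U = powDeriv k X U + powDeriv k Y U := by
  simp [powDeriv, add_mul, mul_add, Finset.sum_add_distrib]

theorem powDeriv_smul (k : ℕ) (c : ℂ) (X U : Matrix (Fin N) (Fin N) ℂ) :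
    powDeriv k (c • X) U = c • powDeriv k X U := by
  simp [powDeriv, Finset.smul_sum]

/-- Passing through a linear functional keeps any choice of matrix norm out of the statement. -/
theorem hasDerivAt_expUnitary_pow {X : Matrix (Fin N) (Fin N) ℂ} (hX : star X = -X) (U : UN N)
    (k : ℕ) (t : ℝ) (φ : Matrix (Fin N) (Fin N) ℂ →ₗ[ℝ] ℂ) :
    HasDerivAt (fun t => φ ((expUnitary X hX t * U).1 ^ k))
      (φ (powDeriv k X (expUnitary X hX t * U).1)) t := by
  open scoped Matrix.Norms.Operator in
  have h1 : HasDerivAt (fun t : ℝ => NormedSpace.exp (t • X) * U.1)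
      (X * (NormedSpace.exp (t • X) * U.1)) t := by
    rw [← mul_assoc]
    exact (hasDerivAt_exp_smul_const' X t).mul_const U.1
  have h2 := h1.fun_pow' k
  exact (LinearMap.toContinuousLinearMap φ).hasFDerivAt.comp_hasDerivAt t h2

/-- The derivative of `U ↦ (U ^ k) i j * conj (tr (U ^ k))` in the direction `X`, in a form that is
complex linear in `X`. -/
def dysonTerm (k : ℕ) (i j : Fin N) (X : Matrix (Fin N) (Fin N) ℂ) (U : UN N) : ℂ :=
  powDeriv k X U.1 i j * starRingEnd ℂ (U.1 ^ k).trace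
    - (U.1 ^ k) i j * (k * (star U.1 ^ k * X).trace)

theorem continuous_dysonTerm (k : ℕ) (i j : Fin N) (X : Matrix (Fin N) (Fin N) ℂ) :
    Continuous (dysonTerm k i j X) := by
  have hc : Continuous fun U : UN N => U.1 := continuous_subtype_val
  have hp : Continuous fun U : UN N => powDeriv k X U.1 :=
    continuous_finsetSum _ fun l _ => ((hc.pow _).mul (continuous_const.mul hc)).mul (hc.pow _)
  refine Continuous.sub ?_ ?_
  · exact (hp.matrix_elem i j).mul (Complex.continuous_conj.comp (continuous_trace_pow k))
  · exact ((hc.pow k).matrix_elem i j).mul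
      (continuous_const.mul ((hc.star.pow k).mul continuous_const).matrix_trace)

theorem dysonTerm_add (k : ℕ) (i j : Fin N) (X Y : Matrix (Fin N) (Fin N) ℂ) (U : UN N) :
    dysonTerm k i j (X + Y) U = dysonTerm k i j X U + dysonTerm k i j Y U := by
  simp only [dysonTerm, powDeriv_add, mul_add, Matrix.trace_add, Matrix.add_apply]
  ring

theorem dysonTerm_smul (k : ℕ) (i j : Fin N) (c : ℂ) (X : Matrix (Fin N) (Fin N) ℂ) (U : UN N) :
    dysonTerm k i j (c • X) U = c * dysonTerm k i j X U := by
  simp only [dysonTerm, powDeriv_smul, Matrix.mul_smul, Matrix.trace_smul, Matrix.smul_apply,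
    smul_eq_mul]
  ring

theorem integral_dysonTerm_of_skew (k : ℕ) (i j : Fin N) {X : Matrix (Fin N) (Fin N) ℂ}
    (hX : star X = -X) : ∫ U, dysonTerm k i j X U ∂(cue N) = 0 := by
  have hc : Continuous fun U : UN N => U.1 := continuous_subtype_val
  refine integral_derivative_eq_zero hX
    (F := fun U => (U.1 ^ k) i j * starRingEnd ℂ (U.1 ^ k).trace)
    (((hc.pow k).matrix_elem i j).mul (Complex.continuous_conj.comp (continuous_trace_pow k)))
    (continuous_dysonTerm k i j X) fun U t => ?_
  have h1 := hasDerivAt_expUnitary_pow hX U k t (Matrix.entryLinearMap ℝ ℂ i j)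
  have h2 := (hasDerivAt_expUnitary_pow hX U k t (Matrix.traceLinearMap (Fin N) ℝ ℂ)).star
  -- Here $X^*=-X$ turns the conjugated derivative of the trace into $-k\,\mathrm{tr}(U^{*k}X)$,
  -- removing the antilinear dependence on $X$.
  have h3 : ∀ W : UN N, dysonTerm k i j X W
      = powDeriv k X W.1 i j * star (W.1 ^ k).trace + (W.1 ^ k) i j * star (powDeriv k X W.1).trace := by
    intro W
    rw [dysonTerm, trace_powDeriv, sub_eq_add_neg, ← mul_neg, ← mul_neg, starRingEnd_apply]
    congr 2
    rw [star_mul', ← Matrix.trace_conjTranspose, ← Matrix.star_eq_conjTranspose, star_mul, star_pow, hX]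
    simp
  rw [h3]
  exact h1.mul h2

/-- Every matrix is $A+iB$ with $A,B$ skew-Hermitian, and `dysonTerm` is complex linear in $X$. -/
theorem integral_dysonTerm (k : ℕ) (i j : Fin N) (X : Matrix (Fin N) (Fin N) ℂ) :
    ∫ U, dysonTerm k i j X U ∂(cue N) = 0 := by
  let A : Matrix (Fin N) (Fin N) ℂ := (1 / 2 : ℂ) • (X - star X)
  let B : Matrix (Fin N) (Fin N) ℂ := (-Complex.I / 2) • (X + star X)
  have hA : star A = -A := by
    simp only [A, star_smul, star_sub, star_star, ← smul_neg, neg_sub]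
    congr 1
    simp
  have hB : star B = -B := by
    simp only [B, star_smul, star_add, star_star, ← neg_smul, add_comm]
    congr 1
    simp [neg_div]
  have hX : X = A + Complex.I • B := by
    simp only [A, B, smul_smul]
    have : Complex.I * (-Complex.I / 2) = 1 / 2 := by
      linear_combination (-1 / 2 : ℂ) * Complex.I_mul_I
    rw [this, ← smul_add, sub_add_add_cancel, ← two_smul ℂ X, smul_smul]
    norm_num
  rw [hX]
  simp only [dysonTerm_add, dysonTerm_smul]
  rw [integral_add (integrable_of_continuous (continuous_dysonTerm k i j A))
    ((integrable_of_continuous (continuous_dysonTerm k i j B)).const_mul _), integral_const_mul,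
    integral_dysonTerm_of_skew k i j hA, integral_dysonTerm_of_skew k i j hB]
  simp

/-- Summing over matrix units splits each $U^{k-1-l}E_{ij}U^{l+1}$ into a product of two traces,
while the conjugate part contracts to $k\,\mathrm{tr}(U^kU^{*k})=kN$. -/
theorem sum_dysonTerm_single (k : ℕ) (U : UN N) :
    ∑ i, ∑ j, dysonTerm k i j (Matrix.single i j 1) U
      = (∑ l ∈ Finset.range k, (U.1 ^ (k - 1 - l)).trace * (U.1 ^ (l + 1)).trace) *
        starRingEnd ℂ (U.1 ^ k).trace - k * N := by
  have h1 : ∀ i j : Fin N, powDeriv k (Matrix.single i j 1) U.1 i j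
      = ∑ l ∈ Finset.range k, (U.1 ^ (k - 1 - l)) i i * (U.1 ^ (l + 1)) j j := by
    intro i j
    rw [powDeriv, Matrix.sum_apply]
    refine Finset.sum_congr rfl fun l _ => ?_
    rw [mul_assoc, mul_assoc, ← pow_succ', Matrix.mul_apply, Finset.sum_eq_single i]
    · rw [Matrix.single_mul_apply_same, one_mul]
    · intro b _ hb
      rw [Matrix.single_mul_apply_of_ne _ _ _ _ _ hb, mul_zero]
    · simp
  have h2 : ∀ i j : Fin N, (star U.1 ^ k * Matrix.single i j 1).trace = (star U.1 ^ k) j i := by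
    intro i j
    rw [Matrix.trace_mul_single]
    simp
  have h3 : ∑ i, ∑ j, (U.1 ^ k) i j * (star U.1 ^ k) j i = N := by
    have h : U.1 ^ k * star U.1 ^ k = 1 := by
      rw [← star_pow]
      exact Matrix.mem_unitaryGroup_iff.1 (U ^ k).2
    have h' := congrArg Matrix.trace h
    rw [Matrix.trace_one, Fintype.card_fin] at h'
    rw [← h', Matrix.trace]
    simp only [Matrix.diag_apply, Matrix.mul_apply]
  simp only [dysonTerm, h1, h2, Finset.sum_sub_distrib]
  congr 1
  · simp only [← Finset.sum_mul]
    congr 1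
    rw [Finset.sum_congr rfl fun i _ => Finset.sum_comm, Finset.sum_comm]
    refine Finset.sum_congr rfl fun l _ => ?_
    simp only [Matrix.trace, Matrix.diag_apply]
    rw [Finset.sum_mul_sum]
  · rw [← h3]
    simp only [Finset.mul_sum]
    exact Finset.sum_congr rfl fun i _ => Finset.sum_congr rfl fun j _ => by ring

/-- The Schwinger–Dyson equation for the second moment of a power sum. -/
theorem schwinger_dyson (N k : ℕ) :
    ∑ l ∈ Finset.range k, ∫ U : UN N, (U.1 ^ (k - 1 - l)).trace * (U.1 ^ (l + 1)).trace *
      starRingEnd ℂ (U.1 ^ k).trace ∂(cue N) = k * N := by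
  have hcont : ∀ l, Continuous fun U : UN N => (U.1 ^ (k - 1 - l)).trace * (U.1 ^ (l + 1)).trace *
      starRingEnd ℂ (U.1 ^ k).trace := fun l =>
    ((continuous_trace_pow _).mul (continuous_trace_pow _)).mul
      (Complex.continuous_conj.comp (continuous_trace_pow k))
  have h : ∫ U : UN N, ∑ i, ∑ j, dysonTerm k i j (Matrix.single i j 1) U ∂(cue N) = 0 := by
    rw [integral_finsetSum _ fun i _ => integrable_finsetSum _ fun j _ =>
      integrable_of_continuous (continuous_dysonTerm k i j _)]
    refine Finset.sum_eq_zero fun i _ => ?_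
    rw [integral_finsetSum _ fun j _ => integrable_of_continuous (continuous_dysonTerm k i j _)]
    exact Finset.sum_eq_zero fun j _ => integral_dysonTerm k i j _
  simp only [sum_dysonTerm_single, Finset.sum_mul] at h
  rw [integral_sub (integrable_finsetSum _ fun l _ => integrable_of_continuous (hcont l))
    (integrable_const _), integral_finsetSum _ fun l _ => integrable_of_continuous (hcont l)] at h
  simpa [sub_eq_zero] using h

end SchwingerDyson

/-! ### Lambert series and Euler's function -/

section Lambert

variable {q : ℝ}

/-- The terms of the Lambert series `∑ q ^ n / ((1 - q ^ n) n)`. -/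
def lambertTerm (q : ℝ) (k : ℕ) : ℝ := q ^ (k + 1) / ((1 - q ^ (k + 1)) * ((k + 1 : ℕ) : ℝ))

theorem one_sub_pow_succ_pos (hq0 : 0 ≤ q) (hq1 : q < 1) (k : ℕ) : 0 < 1 - q ^ (k + 1) :=
  sub_pos.2 (pow_lt_one₀ hq0 hq1 (Nat.succ_ne_zero k))

theorem lambertTerm_nonneg (hq0 : 0 ≤ q) (hq1 : q < 1) (k : ℕ) : 0 ≤ lambertTerm q k := by
  have := one_sub_pow_succ_pos hq0 hq1 k
  unfold lambertTerm
  positivity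

theorem summable_lambertTerm (hq0 : 0 ≤ q) (hq1 : q < 1) : Summable (lambertTerm q) := by
  refine Summable.of_nonneg_of_le (lambertTerm_nonneg hq0 hq1) (fun k => ?_)
    (((summable_nat_add_iff 1).2 (summable_geometric_of_lt_one hq0 hq1)).div_const (1 - q))
  have h1 : 0 < 1 - q := sub_pos.2 hq1
  have h2 : q ^ (k + 1) ≤ q := pow_le_of_le_one hq0 hq1.le (Nat.succ_ne_zero k)
  refine div_le_div_of_nonneg_left (by positivity) h1 ?_
  have h3 : (1 : ℝ) ≤ ((k + 1 : ℕ) : ℝ) := by norm_cast; omega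
  nlinarith

/-- The double series $\sum_{k,n\ge1}q^{kn}/k$ is summed in both orders: over $n$ it is geometric
and gives a Lambert term, over $k$ it is the logarithm. -/
theorem hasSum_neg_log_one_sub_pow (hq0 : 0 ≤ q) (hq1 : q < 1) :
    HasSum (fun n : ℕ => -Real.log (1 - q ^ (n + 1))) (∑' k, lambertTerm q k) := by
  let f : ℕ × ℕ → ℝ := fun p => (q ^ (p.1 + 1)) ^ (p.2 + 1) / ((p.1 + 1 : ℕ) : ℝ)
  have hcol : ∀ k, HasSum (fun n => f (k, n)) (lambertTerm q k) := by
    intro k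
    have h := ((hasSum_geometric_of_lt_one (pow_nonneg hq0 (k + 1))
      (pow_lt_one₀ hq0 hq1 (Nat.succ_ne_zero k))).mul_left (q ^ (k + 1))).div_const ((k + 1 : ℕ) : ℝ)
    simp only [← pow_succ', ← div_eq_mul_inv, div_div] at h
    exact h
  have hsum : Summable f := by
    rw [summable_prod_of_nonneg fun p => by positivity]
    refine ⟨fun k => (hcol k).summable, ?_⟩
    simp only [(hcol _).tsum_eq]
    exact summable_lambertTerm hq0 hq1
  have htot : HasSum f (∑' k, lambertTerm q k) := by
    rw [(hsum.hasSum.prod_fiberwise hcol).tsum_eq]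
    exact hsum.hasSum
  refine ((Equiv.prodComm ℕ ℕ).hasSum_iff.2 htot).prod_fiberwise fun n => ?_
  have h := Real.hasSum_pow_div_log_of_abs_lt_one (x := q ^ (n + 1)) (by
    rw [abs_of_nonneg (by positivity)]
    exact pow_lt_one₀ hq0 hq1 (Nat.succ_ne_zero n))
  convert h using 2 with k
  simp only [f, Function.comp_apply, Equiv.prodComm_apply, Prod.swap_prod_mk]
  rw [pow_right_comm]
  push_cast
  rfl

theorem summable_log_one_sub_pow (hq0 : 0 ≤ q) (hq1 : q < 1) :
    Summable fun n : ℕ => Real.log (1 - q ^ (n + 1)) := by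
  simpa using (hasSum_neg_log_one_sub_pow hq0 hq1).summable.neg

theorem multipliable_one_sub_pow (hq0 : 0 ≤ q) (hq1 : q < 1) :
    Multipliable fun n : ℕ => 1 - q ^ (n + 1) :=
  Real.multipliable_of_summable_log (one_sub_pow_succ_pos hq0 hq1)
    (summable_log_one_sub_pow hq0 hq1)

theorem exp_neg_lambert_eq_eulerPhi (hq0 : 0 ≤ q) (hq1 : q < 1) :
    Real.exp (-∑' k, lambertTerm q k) = eulerPhi q := by
  rw [eulerPhi, ← Real.rexp_tsum_eq_tprod (one_sub_pow_succ_pos hq0 hq1)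
    (summable_log_one_sub_pow hq0 hq1)]
  congr 1
  rw [← (hasSum_neg_log_one_sub_pow hq0 hq1).tsum_eq, tsum_neg, neg_neg]

theorem eulerPhi_pos (hq0 : 0 ≤ q) (hq1 : q < 1) : 0 < eulerPhi q := by
  rw [← exp_neg_lambert_eq_eulerPhi hq0 hq1]
  exact Real.exp_pos _

theorem log_eulerPhi (hq0 : 0 ≤ q) (hq1 : q < 1) :
    Real.log (eulerPhi q) = -∑' k, lambertTerm q k := by
  rw [← exp_neg_lambert_eq_eulerPhi hq0 hq1, Real.log_exp]

/-- The split-off $n=1$ term is exactly the limit of $\mathbb E\log Z_N$. -/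
theorem tsum_lambertTerm (hq0 : 0 ≤ q) (hq1 : q < 1) :
    ∑' k, lambertTerm q k = q / (1 - q) + ∑' k, lambertTerm q (k + 1) := by
  rw [(summable_lambertTerm hq0 hq1).tsum_eq_zero_add]
  simp [lambertTerm]

theorem log_prod_inv_one_sub_pow (hq0 : 0 ≤ q) (hq1 : q < 1) (N : ℕ) :
    Real.log (∏ k : Fin N, (1 - q ^ ((k : ℕ) + 1))⁻¹)
      = ∑ k ∈ Finset.range N, -Real.log (1 - q ^ (k + 1)) := by
  rw [Fin.prod_univ_eq_prod_range (fun k => (1 - q ^ (k + 1))⁻¹) N, Real.log_prod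
    fun k _ => inv_ne_zero (one_sub_pow_succ_pos hq0 hq1 k).ne']
  exact Finset.sum_congr rfl fun k _ => Real.log_inv _

/-- Bounds $\mathbb E Z_N$ uniformly in $N$; all moment estimates below rest on it. -/
theorem prod_inv_one_sub_pow_le (hq0 : 0 ≤ q) (hq1 : q < 1) (N : ℕ) :
    ∏ k : Fin N, (1 - q ^ ((k : ℕ) + 1))⁻¹ ≤ Real.exp (∑' k, lambertTerm q k) := by
  have hpos : 0 < ∏ k : Fin N, (1 - q ^ ((k : ℕ) + 1))⁻¹ :=
    Finset.prod_pos fun k _ => inv_pos.2 (one_sub_pow_succ_pos hq0 hq1 k)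
  rw [← Real.log_le_iff_le_exp hpos, log_prod_inv_one_sub_pow hq0 hq1]
  refine sum_le_hasSum _ (fun k _ => ?_) (hasSum_neg_log_one_sub_pow hq0 hq1)
  refine neg_nonneg.2 (Real.log_nonpos (one_sub_pow_succ_pos hq0 hq1 k).le ?_)
  have := pow_nonneg hq0 (k + 1)
  linarith

end Lambert

/-! ### Uniform moment bounds and the limit -/

section Moments

variable {N : ℕ} {q : ℝ}

theorem norm_sq_trace_pow_le (hq0 : 0 < q) (hq1 : q < 1) (U : UN N) (k : ℕ) :
    q ^ (k + 1) / ((k + 1 : ℕ) : ℝ) * ‖(U.1 ^ (k + 1)).trace‖ ^ 2 ≤ logPartition q U :=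
  le_hasSum (hasSum_logPartition hq0.le hq1 U) k fun j _ => by positivity

/-- Combines $|abc|\le|a|^2|b|^2+|c|^2$ with $S^2\le2e^S$ and $S\le e^S$. With $S=\log Z_N$, one
exponential moment controls all triple products of traces. -/
theorem norm_mul_mul_le {S D : ℝ} (hD : 0 ≤ D) {a b c : ℂ} (ha : ‖a‖ ^ 2 ≤ D * S)
    (hb : ‖b‖ ^ 2 ≤ D * S) (hc : ‖c‖ ^ 2 ≤ D * S) (hS : 0 ≤ S) :
    ‖a * b * c‖ ≤ (2 * D ^ 2 + D) * Real.exp S := by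
  have h1 : S ≤ Real.exp S := by linarith [Real.add_one_le_exp S]
  have h2 : S ^ 2 ≤ 2 * Real.exp S := by linarith [Real.quadratic_le_exp_of_nonneg hS]
  have h3 : ‖a * b * c‖ ≤ ‖a‖ ^ 2 * ‖b‖ ^ 2 + ‖c‖ ^ 2 := by
    rw [norm_mul, norm_mul, ← mul_pow]
    nlinarith [sq_nonneg (‖a‖ * ‖b‖ - ‖c‖), sq_nonneg (‖a‖ * ‖b‖), sq_nonneg ‖c‖]
  have h4 : ‖a‖ ^ 2 * ‖b‖ ^ 2 ≤ (D * S) * (D * S) := by gcongr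
  have h5 : D ^ 2 * S ^ 2 ≤ D ^ 2 * (2 * Real.exp S) := by gcongr
  have h6 : D * S ≤ D * Real.exp S := by gcongr
  calc ‖a * b * c‖ ≤ D ^ 2 * S ^ 2 + D * S := by linarith
    _ ≤ _ := by linarith

/-- At the parameter $1/2$ (any fixed value in $(0,1)$ would serve) $\log Z_N$ dominates each
$|\mathrm{tr}\,U^m|^2$ up to the factor $m2^m$, and $\mathbb E Z_N\le1/\phi(1/2)$ for every $N$. -/
theorem exists_norm_integral_trace_mul_le (K : ℕ) :
    ∃ B : ℝ, ∀ N : ℕ, ∀ a ≤ K, ∀ b ≤ K, ∀ c ≤ K,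
      ‖∫ U : UN N, (U.1 ^ (a + 1)).trace * (U.1 ^ (b + 1)).trace *
        starRingEnd ℂ (U.1 ^ (c + 1)).trace ∂(cue N)‖ ≤ B := by
  have h0 : (0 : ℝ) < 1 / 2 := by norm_num
  have h1 : (1 / 2 : ℝ) < 1 := by norm_num
  let D : ℝ := ((K + 1 : ℕ) : ℝ) * 2 ^ (K + 1)
  have hD : 0 ≤ D := by positivity
  refine ⟨(2 * D ^ 2 + D) * Real.exp (∑' k, lambertTerm (1 / 2) k), fun N a ha b hb c hc => ?_⟩
  have hS : ∀ U : UN N, 0 ≤ logPartition (1 / 2) U := fun U =>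
    le_trans (by positivity) (norm_sq_trace_pow_le h0 h1 U 0)
  have hb' : ∀ (U : UN N) (m : ℕ), m ≤ K →
      ‖(U.1 ^ (m + 1)).trace‖ ^ 2 ≤ D * logPartition (1 / 2) U := by
    intro U m hm
    have h := norm_sq_trace_pow_le h0 h1 U m
    have hc : ((m + 1 : ℕ) : ℝ) * 2 ^ (m + 1) ≤ D := by
      simp only [D]
      gcongr
      norm_num
    calc ‖(U.1 ^ (m + 1)).trace‖ ^ 2
        = (((m + 1 : ℕ) : ℝ) * 2 ^ (m + 1)) *
          ((1 / 2) ^ (m + 1) / ((m + 1 : ℕ) : ℝ) * ‖(U.1 ^ (m + 1)).trace‖ ^ 2) := by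
          have : ((m + 1 : ℕ) : ℝ) ≠ 0 := by positivity
          rw [one_div, inv_pow]
          field_simp
      _ ≤ D * logPartition (1 / 2) U := by
          gcongr
  have hcont := continuous_logPartition (N := N) h0.le h1
  refine (norm_integral_le_of_norm_le
    (g := fun U => (2 * D ^ 2 + D) * Real.exp (logPartition (1 / 2) U))
    (integrable_of_continuous (continuous_const.mul (Real.continuous_exp.comp hcont)))
    (Eventually.of_forall fun U => norm_mul_mul_le hD (hb' U a ha) (hb' U b hb)
      (by rw [RCLike.norm_conj]; exact hb' U c hc) (hS U))).trans ?_
  rw [integral_const_mul]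
  gcongr
  refine (integral_exp_logPartition N h0.le h1).trans_le ?_
  exact prod_inv_one_sub_pow_le h0.le h1 N

/-- Power sums of Haar unitary matrices are asymptotically Gaussian to second order. -/
theorem tendsto_integral_norm_sq_trace_pow (K : ℕ) :
    Tendsto (fun N : ℕ => ∫ U : UN N, ‖(U.1 ^ (K + 1)).trace‖ ^ 2 ∂(cue N)) atTop
      (𝓝 ((K + 1 : ℕ) : ℝ)) := by
  obtain ⟨B, hB⟩ := exists_norm_integral_trace_mul_le K
  have key : ∀ N : ℕ, (N : ℝ) *
      |∫ U : UN N, ‖(U.1 ^ (K + 1)).trace‖ ^ 2 ∂(cue N) - ((K + 1 : ℕ) : ℝ)| ≤ K * B := by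
    intro N
    have h := schwinger_dyson N (K + 1)
    -- The last term contains $\mathrm{tr}\,U^0=N$ and so equals $N\,\mathbb
    -- E|\mathrm{tr}\,U^{K+1}|^2$. In the other $K$ terms all exponents are positive, so each is at
    -- most `B` in norm; dividing by $N$ gives an error $O(1/N)$.
    rw [Finset.sum_range_succ] at h
    have hlast : ∫ U : UN N, (U.1 ^ (K + 1 - 1 - K)).trace * (U.1 ^ (K + 1)).trace *
        starRingEnd ℂ (U.1 ^ (K + 1)).trace ∂(cue N)
        = ((N * ∫ U : UN N, ‖(U.1 ^ (K + 1)).trace‖ ^ 2 ∂(cue N) : ℝ) : ℂ) := by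
      rw [← integral_const_mul, ← integral_complex_ofReal]
      congr 1
      funext U
      rw [mul_assoc, Complex.mul_conj, Complex.normSq_eq_norm_sq]
      simp
    rw [hlast] at h
    have hsum : ‖∑ l ∈ Finset.range K, ∫ U : UN N, (U.1 ^ (K + 1 - 1 - l)).trace *
        (U.1 ^ (l + 1)).trace * starRingEnd ℂ (U.1 ^ (K + 1)).trace ∂(cue N)‖ ≤ K * B := by
      refine (norm_sum_le_of_le _ fun l hl => ?_ : _ ≤ ∑ l ∈ Finset.range K, B).trans (by simp)
      rw [Finset.mem_range] at hl
      have he : K + 1 - 1 - l = (K - 1 - l) + 1 := by omega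
      rw [he]
      exact hB N _ (by omega) _ (by omega) _ le_rfl
    have hval : ∑ l ∈ Finset.range K, ∫ U : UN N, (U.1 ^ (K + 1 - 1 - l)).trace *
        (U.1 ^ (l + 1)).trace * starRingEnd ℂ (U.1 ^ (K + 1)).trace ∂(cue N)
        = ((-(N * (∫ U : UN N, ‖(U.1 ^ (K + 1)).trace‖ ^ 2 ∂(cue N) - ((K + 1 : ℕ) : ℝ))) : ℝ) : ℂ) := by
      rw [eq_sub_of_add_eq h]
      push_cast
      ring
    rw [hval, Complex.norm_real, norm_neg, norm_mul, Real.norm_of_nonneg (Nat.cast_nonneg N)] at hsum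
    exact hsum
  rw [tendsto_iff_norm_sub_tendsto_zero]
  refine squeeze_zero' (Eventually.of_forall fun N => norm_nonneg _) ?_
    (tendsto_const_div_atTop_nhds_zero_nat (K * B))
  filter_upwards [eventually_gt_atTop 0] with N hN
  rw [le_div_iff₀ (by exact_mod_cast hN), mul_comm]
  exact key N

theorem tendsto_integral_logPartition (hq0 : 0 < q) (hq1 : q < 1) :
    Tendsto (fun N : ℕ => ∫ U : UN N, logPartition q U ∂(cue N)) atTop (𝓝 (q / (1 - q))) := by
  -- Any $r\in(q,1)$ would do: $\frac{r^k}{k}\mathbb E|\mathrm{tr}\,U^k|^2\le\mathbb E\log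
  -- Z_N\le\mathbb E Z_N\le C$ at the parameter $r$, so the series at $q$ is dominated by $C(q/r)^k$
  -- uniformly in $N$.
  let r := (q + 1) / 2
  have hr0 : 0 < r := by simp only [r]; linarith
  have hqr : q < r := by simp only [r]; linarith
  have hr1 : r < 1 := by simp only [r]; linarith
  have hratio : q / r < 1 := (div_lt_one hr0).2 hqr
  let C := Real.exp (∑' k, lambertTerm r k)
  have hlim : ∑' k : ℕ, q ^ (k + 1) / ((k + 1 : ℕ) : ℝ) * ((k + 1 : ℕ) : ℝ) = q / (1 - q) := by
    have h : ∀ k : ℕ, q ^ (k + 1) / ((k + 1 : ℕ) : ℝ) * ((k + 1 : ℕ) : ℝ) = q * q ^ k := fun k => by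
      rw [div_mul_cancel₀ _ (by positivity), pow_succ']
    simp only [h]
    rw [tsum_mul_left, tsum_geometric_of_lt_one hq0.le hq1]
    rfl
  have hint : ∀ N : ℕ, ∫ U : UN N, logPartition q U ∂(cue N)
      = ∑' k : ℕ, q ^ (k + 1) / ((k + 1 : ℕ) : ℝ) *
        ∫ U : UN N, ‖(U.1 ^ (k + 1)).trace‖ ^ 2 ∂(cue N) := fun N =>
    (hasSum_integral_logPartition N hq0.le hq1).tsum_eq.symm
  simp only [hint]
  rw [← hlim]
  refine tendsto_tsum_of_dominated_convergence (bound := fun k => (q / r) ^ (k + 1) * C)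
    (((summable_nat_add_iff 1).2
      (summable_geometric_of_lt_one (by positivity) hratio)).mul_right C)
    (fun k => (tendsto_integral_norm_sq_trace_pow k).const_mul _)
    (Eventually.of_forall fun N k => ?_)
  have hm : 0 ≤ ∫ U : UN N, ‖(U.1 ^ (k + 1)).trace‖ ^ 2 ∂(cue N) :=
    integral_nonneg fun U => by positivity
  rw [Real.norm_of_nonneg (by positivity)]
  have h1 : r ^ (k + 1) / ((k + 1 : ℕ) : ℝ) * ∫ U : UN N, ‖(U.1 ^ (k + 1)).trace‖ ^ 2 ∂(cue N) ≤ C := by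
    refine (le_hasSum (hasSum_integral_logPartition N hr0.le hr1) k fun j _ =>
      mul_nonneg (by positivity) (integral_nonneg fun U => by positivity)).trans ?_
    have hcont := continuous_logPartition (N := N) hr0.le hr1
    refine (integral_mono (integrable_of_continuous hcont)
      (integrable_of_continuous (Real.continuous_exp.comp hcont))
      fun U => ?_).trans ((integral_exp_logPartition N hr0.le hr1).trans_le
        (prod_inv_one_sub_pow_le hr0.le hr1 N))
    simp only [Function.comp_apply]
    linarith [Real.add_one_le_exp (logPartition r U)]
  calc q ^ (k + 1) / ((k + 1 : ℕ) : ℝ) * ∫ U : UN N, ‖(U.1 ^ (k + 1)).trace‖ ^ 2 ∂(cue N)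
      = (q / r) ^ (k + 1) * (r ^ (k + 1) / ((k + 1 : ℕ) : ℝ) *
          ∫ U : UN N, ‖(U.1 ^ (k + 1)).trace‖ ^ 2 ∂(cue N)) := by
        rw [div_pow]
        field_simp
    _ ≤ (q / r) ^ (k + 1) * C := by gcongr

theorem disorderGap_eq (hq0 : 0 ≤ q) (hq1 : q < 1) (N : ℕ) :
    disorderGap q N = ∑ k ∈ Finset.range N, -Real.log (1 - q ^ (k + 1))
      - ∫ U : UN N, logPartition q U ∂(cue N) := by
  simp only [disorderGap, partitionFunction_eq_exp hq0 hq1, Real.log_exp]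
  rw [integral_exp_logPartition N hq0 hq1, log_prod_inv_one_sub_pow hq0 hq1]

theorem tendsto_disorderGap (hq0 : 0 < q) (hq1 : q < 1) :
    Tendsto (fun N : ℕ => disorderGap q N) atTop (𝓝 (∑' k, lambertTerm q (k + 1))) := by
  simp only [disorderGap_eq hq0.le hq1]
  have h := (hasSum_neg_log_one_sub_pow hq0.le hq1).tendsto_sum_nat.sub
    (tendsto_integral_logPartition hq0 hq1)
  rwa [tsum_lambertTerm hq0.le hq1, add_sub_cancel_left] at h

end Moments

end SchurCUE

end

theorem mainTheorem1 (q : ℝ) (hq0 : 0 < q) (hq1 : q < 1) :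
    -- the random variables `Z_N` and `log Z_N` are well defined and have expectations
    (∀ (N : ℕ) (U : SchurCUE.UN N),
      Summable (fun lam : SchurCUE.YN N => q ^ lam.size * ‖SchurCUE.schur lam U‖ ^ 2) ∧
      0 < SchurCUE.partitionFunction q U) ∧
    (∀ N : ℕ,
      Integrable (fun U => SchurCUE.partitionFunction q U) (SchurCUE.cue N) ∧
      Integrable (fun U => Real.log (SchurCUE.partitionFunction q U)) (SchurCUE.cue N)) ∧
    -- the gap converges to the Lambert series, here summed over `n = k + 2`
    Summable (fun k : ℕ => q ^ (k + 2) / ((1 - q ^ (k + 2)) * ((k + 2 : ℕ) : ℝ))) ∧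
    Tendsto (fun N : ℕ => SchurCUE.disorderGap q N) atTop
      (𝓝 (∑' k : ℕ, q ^ (k + 2) / ((1 - q ^ (k + 2)) * ((k + 2 : ℕ) : ℝ)))) ∧
    -- closed form through Euler's function
    Multipliable (fun n : ℕ => 1 - q ^ (n + 1)) ∧ 0 < SchurCUE.eulerPhi q ∧
    ∑' k : ℕ, q ^ (k + 2) / ((1 - q ^ (k + 2)) * ((k + 2 : ℕ) : ℝ))
      = -Real.log (SchurCUE.eulerPhi q) - q / (1 - q) ∧
    -- the limit is strictly positive
    0 < ∑' k : ℕ, q ^ (k + 2) / ((1 - q ^ (k + 2)) * ((k + 2 : ℕ) : ℝ)) := by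
  have hterm : ∀ k : ℕ, q ^ (k + 2) / ((1 - q ^ (k + 2)) * ((k + 2 : ℕ) : ℝ))
      = SchurCUE.lambertTerm q (k + 1) := fun k => rfl
  have hsum : Summable fun k => SchurCUE.lambertTerm q (k + 1) :=
    (summable_nat_add_iff 1).2 (SchurCUE.summable_lambertTerm hq0.le hq1)
  simp only [hterm]
  refine ⟨fun N U => ⟨(SchurCUE.hasSum_partitionFunction hq0.le hq1 U).summable, ?_⟩,
    fun N => ?_, hsum, SchurCUE.tendsto_disorderGap hq0 hq1,
    SchurCUE.multipliable_one_sub_pow hq0.le hq1, SchurCUE.eulerPhi_pos hq0.le hq1, ?_, ?_⟩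
  · rw [SchurCUE.partitionFunction_eq_exp hq0.le hq1]
    exact Real.exp_pos _
  · simp only [SchurCUE.partitionFunction_eq_exp hq0.le hq1, Real.log_exp]
    have hc := SchurCUE.continuous_logPartition (N := N) hq0.le hq1
    exact ⟨SchurCUE.integrable_of_continuous (Real.continuous_exp.comp hc),
      SchurCUE.integrable_of_continuous hc⟩
  · rw [SchurCUE.log_eulerPhi hq0.le hq1, SchurCUE.tsum_lambertTerm hq0.le hq1]
    ring
  · refine hsum.tsum_pos (fun k => SchurCUE.lambertTerm_nonneg hq0.le hq1 _) 0 ?_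
    have := SchurCUE.one_sub_pow_succ_pos hq0.le hq1 1
    unfold SchurCUE.lambertTerm
    positivity
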